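/- **Setting.** A weighted line graph has slots $V=\{1,\dots,m\}$, $m\ge 3$, placed in this order on a path whose edges have positive weights; $d(u,v)$ is the weight of the path between $u$ and $v$, $d_{\max}$ is the largest distance between two slots and $d_{\min}$ the smallest distance between two different slots. Cars $1,\dots,n$ ($n\le m$) with goals $g(1),\dots,g(n)\in V$ (not necessarily different) arrive one at a time. Before car $i$ arrives, given the slots $x(1),\dots,x(i-1)$ taken so far, a randomized dynamic pricing scheme, which does not see the goals, posts a random fee $P_i(v)$ for every vacant slot $v$; car $i$ then parks at a vacant slot $x(i)$ that minimizes $d(g(i),v)+P_i(v)$ over the vacant slots $v$ (ties broken arbitrarily). The resulting random $x$ is called an equilibrium assignment. Its social cost is $\sum_{i=1}^n d(g(i),x(i))$; let $\mathrm{OPT}(g)$ be the minimum of $\sum_{i=1}^n d(g(i),y(i))$ over all injective $y:\{1,\dots,n\}\to V$. A block is a maximal contiguous run of occupied slots. The *Harmonic Payment Conditions* require that, just before each car $i$ parks, conditionally on $x(1),\dots,x(i-1)$: 1. for every block whose nearest vacant slots $L$ to its left and $R$ to its right both exist, $P_i(L)-P_i(R)$ is uniformly distributed on $[-d(L,R),d(L,R)]$;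 2. almost surely, $-d(u,v)<P_i(u)-P_i(v)<d(u,v)$ for all vacant $u\ne v$ with no vacant slot between them. **Theorem.** There is an absolute constant $C>0$ such that for every weighted line graph with $m\ge3$ slots, every $n\le m$, all goals $g$, every randomized dynamic pricing scheme and every equilibrium assignment $x$ for which the Harmonic Payment Conditions hold, $$\mathbb E\Big[\sum_{i=1}^n d(g(i),x(i))\Big]\;\le\; C\cdot\min\Big\{\log\frac{d_{\max}}{d_{\min}},\,n^2\Big\}\cdot \mathrm{OPT}(g).$$ -/

import Mathlib

open MeasureTheory ProbabilityTheory
open scoped ENNReal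

/-- A weighted line graph on the slots `0, 1, …, m - 1`: the edge `k` joins the slots `k` and
`k + 1` and has the positive weight `weight k`. -/
structure WeightedLine (m : ℕ) where
  weight : Fin (m - 1) → ℝ
  weight_pos : ∀ k, 0 < weight k

namespace WeightedLine

/-- The distance of two slots: the weight of the path that joins them in the line graph, that is,
the sum of the weights of all edges between them. -/
noncomputable def dist {m : ℕ} (G : WeightedLine m) (u v : Fin m) : ℝ :=
  ∑ k ∈ Finset.univ.filter (fun k : Fin (m - 1) =>
      min u.val v.val ≤ k.val ∧ k.val < max u.val v.val), G.weight k

/-- The largest distance between two slots. -/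
noncomputable def dMax {m : ℕ} (G : WeightedLine m) : ℝ :=
  ⨆ q : Fin m × Fin m, G.dist q.1 q.2

/-- The smallest distance between two different slots. -/
noncomputable def dMin {m : ℕ} (G : WeightedLine m) : ℝ :=
  ⨅ q : {q : Fin m × Fin m // q.1 ≠ q.2}, G.dist q.1.1 q.1.2

/-- The social cost of an assignment `y` of cars to slots, for the goals `g`: the sum of all the
cars' distances from their goals (fees are not counted). -/
noncomputable def socialCost {m n : ℕ} (G : WeightedLine m) (g y : Fin n → Fin m) : ℝ :=
  ∑ i, G.dist (g i) (y i)

/-- The social cost of an optimal assignment: the minimum over all assignments that give different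
slots to different cars. -/
noncomputable def optCost {m n : ℕ} (G : WeightedLine m) (g : Fin n → Fin m) : ℝ :=
  ⨅ y : Fin n ↪ Fin m, G.socialCost g y

end WeightedLine

/-- A randomized dynamic pricing scheme for `n` cars and `m` slots, with random bits `ω : Ω`:
`P i h v ω` is the fee posted for the slot `v` before car `i` arrives, when the earlier cars
`j < i` are parked at the slots `h j`. Only the fees of the vacant slots matter. -/
abbrev PricingScheme (m n : ℕ) (Ω : Type*) : Type _ :=
  (i : Fin n) → (Fin (i : ℕ) → Fin m) → Fin m → Ω → ℝ

/-- The slots taken by the cars before car `i`, when car `j` parks at `x j ω`. -/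
def parkedBefore {m n : ℕ} {Ω : Type*} (x : Fin n → Ω → Fin m) (i : Fin n) (ω : Ω) :
    Fin (i : ℕ) → Fin m :=
  fun j => x (Fin.castLE i.isLt.le j) ω

/-- The random assignment `x` is an equilibrium of the pricing scheme `P` for the goals `g`:
almost surely every car takes a vacant slot that minimizes, over all slots that are vacant when it
arrives, its distance from its goal plus the posted fee. Ties may be broken in any way. -/
def IsEquilibrium {m n : ℕ} {Ω : Type*} [MeasurableSpace Ω] (μ : Measure Ω) (G : WeightedLine m)
    (P : PricingScheme m n Ω) (g : Fin n → Fin m) (x : Fin n → Ω → Fin m) : Prop :=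
  ∀ᵐ ω ∂μ, ∀ i : Fin n,
    x i ω ∉ Set.range (parkedBefore x i ω) ∧
    ∀ v, v ∉ Set.range (parkedBefore x i ω) →
      G.dist (g i) (x i ω) + P i (parkedBefore x i ω) (x i ω) ω ≤
        G.dist (g i) v + P i (parkedBefore x i ω) v ω

/-- `u < v` are vacant slots without a vacant slot between them. -/
def ConsecutiveVacant {m : ℕ} (occ : Set (Fin m)) (u v : Fin m) : Prop :=
  u ∉ occ ∧ v ∉ occ ∧ u < v ∧ ∀ w, u < w → w < v → w ∈ occ

/-- `u` and `v` are the first vacant slots to the left and to the right of a block, a block being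
a maximal (nonempty) contiguous run of occupied slots; the block consists of all slots strictly
between `u` and `v`. -/
def FlanksBlock {m : ℕ} (occ : Set (Fin m)) (u v : Fin m) : Prop :=
  ConsecutiveVacant occ u v ∧ ∃ w, u < w ∧ w < v

/-- The Harmonic Payment Conditions for the random price function `p : slots → ℝ`, under the
law `ν`, when the occupied slots are `occ`. -/
def HarmonicPrices {m : ℕ} {Ω : Type*} [MeasurableSpace Ω] (ν : Measure Ω) (G : WeightedLine m)
    (occ : Set (Fin m)) (p : Fin m → Ω → ℝ) : Prop :=
  (∀ u v, FlanksBlock occ u v →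
    pdf.IsUniform (fun ω => p u ω - p v ω) (Set.Icc (-G.dist u v) (G.dist u v)) ν volume) ∧
  ∀ᵐ ω ∂ν, ∀ u v, ConsecutiveVacant occ u v →
    -G.dist u v < p u ω - p v ω ∧ p u ω - p v ω < G.dist u v

/-- The pricing scheme `P` satisfies the Harmonic Payment Conditions along the play `x`: just
before any car `i` parks, given that the earlier cars are parked at the slots `h j` (for any `h`
that has positive probability), the conditional law of the posted prices satisfies them. -/
def HarmonicPaymentConditions {m n : ℕ} {Ω : Type*} [MeasurableSpace Ω] (μ : Measure Ω)
    (G : WeightedLine m) (P : PricingScheme m n Ω) (x : Fin n → Ω → Fin m) : Prop :=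
  ∀ (i : Fin n) (h : Fin (i : ℕ) → Fin m), μ {ω | parkedBefore x i ω = h} ≠ 0 →
    HarmonicPrices (μ[|{ω | parkedBefore x i ω = h}]) G (Set.range h) (P i h)

/-! The prices are a disguised harmonic algorithm. Strict bounds on fee differences drive a car to a
vacant slot `L` or `R` next to its goal `g`, and uniformity of `P L - P R` makes it choose `L` with
probability `d(g, R) / d(L, R)`; ties have probability zero. Hence the expected social cost equals
the deterministic recursion `harmonicCost` on positions in the real line (`integral_socialCost`).

The core is a sensitivity estimate for the expected remaining cost `V`. Take two free sets that
differ only in having `u` or `v`, with no free point between, and let `D = v - u`. When the next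
request is served in both, the discrepancy disappears, persists, or widens to a gap `E ≥ D`, the
latter with probability inversely proportional to `E`. Therefore a bound `D * ψ D` survives one more
request if `ψ k E + 2 * (E - D) / E ≤ ψ (k + 1) D`, the extra term paying for the change in
distances (`AdjacentBound.step`). Two solutions are used: `1 + 2 * log (dMax / D)`, independent of
`k` because `1 - D / E ≤ log (E / D)`, and `1 + 2 * k`.

Summing over adjacent gaps, `V (F.erase a)` is Lipschitz in `a` with constant `α = sup ψ`. Replacing
the harmonic choices by those of an optimal assignment, one request at a time, then costs a factor
`2 + 3 * α` (`harmonicStep_le`, `harmonicCost_le`). The second solution gives a factor linear in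
`n`, stronger than `n ^ 2`. -/

/-! ### The harmonic choice between neighbouring free points. -/

/-- The expectation of `φ X`, where `X` is the harmonic random choice of a point of `F` next to `r`:
among the nearest points `L ≤ r ≤ R` of `F`, it takes `L` with probability `(R - r) / (R - L)`
and `R` with probability `(r - L) / (R - L)`; if only one of them exists, it takes that one. -/
noncomputable def harmonicExp (F : Finset ℝ) (r : ℝ) (φ : ℝ → ℝ) : ℝ :=
  if h : (F.filter (fun w => w ≤ r)).Nonempty then
    if h' : (F.filter (fun w => r ≤ w)).Nonempty then
      let L := (F.filter (fun w => w ≤ r)).max' h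
      let R := (F.filter (fun w => r ≤ w)).min' h'
      if L = R then φ L else ((R - r) * φ L + (r - L) * φ R) / (R - L)
    else φ ((F.filter (fun w => w ≤ r)).max' h)
  else if h' : (F.filter (fun w => r ≤ w)).Nonempty then
    φ ((F.filter (fun w => r ≤ w)).min' h') else 0

lemma filter_le_max'_eq {F : Finset ℝ} {r L : ℝ} (hL : L ∈ F) (hLr : L ≤ r)
    (hgap : ∀ w ∈ F, w ≤ r → w ≤ L) (h : (F.filter (fun w => w ≤ r)).Nonempty) :
    (F.filter (fun w => w ≤ r)).max' h = L := by
  apply le_antisymm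
  · apply Finset.max'_le
    intro w hw
    rw [Finset.mem_filter] at hw
    exact hgap w hw.1 hw.2
  · exact Finset.le_max' _ _ (Finset.mem_filter.2 ⟨hL, hLr⟩)

lemma filter_ge_min'_eq {F : Finset ℝ} {r R : ℝ} (hR : R ∈ F) (hRr : r ≤ R)
    (hgap : ∀ w ∈ F, r ≤ w → R ≤ w) (h : (F.filter (fun w => r ≤ w)).Nonempty) :
    (F.filter (fun w => r ≤ w)).min' h = R := by
  apply le_antisymm
  · exact Finset.min'_le _ _ (Finset.mem_filter.2 ⟨hR, hRr⟩)
  · apply Finset.le_min'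
    intro w hw
    rw [Finset.mem_filter] at hw
    exact hgap w hw.1 hw.2

lemma harmonicExp_between {F : Finset ℝ} {r L R : ℝ} (φ : ℝ → ℝ) (hL : L ∈ F) (hR : R ∈ F)
    (hLR : L < R) (hLr : L ≤ r) (hrR : r ≤ R) (hgap : ∀ w ∈ F, w ≤ L ∨ R ≤ w) :
    harmonicExp F r φ = ((R - r) * φ L + (r - L) * φ R) / (R - L) := by
  have h : (F.filter (fun w => w ≤ r)).Nonempty := ⟨L, Finset.mem_filter.2 ⟨hL, hLr⟩⟩
  have h' : (F.filter (fun w => r ≤ w)).Nonempty := ⟨R, Finset.mem_filter.2 ⟨hR, hrR⟩⟩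
  have hne : R - L ≠ 0 := by linarith
  rw [harmonicExp, dif_pos h, dif_pos h']
  -- If `r` is `L` or `R`, both neighbours in the definition are `r` itself; the interpolation
  -- formula agrees, its other weight being zero.
  rcases eq_or_lt_of_le hLr with e | hLr'
  · subst e
    have e1 := filter_le_max'_eq hL le_rfl (fun w _ hw => hw) h
    have e2 := filter_ge_min'_eq hL le_rfl (fun w _ hw => hw) h'
    simp only [e1, e2, if_true]
    field_simp
    ring
  rcases eq_or_lt_of_le hrR with e | hrR'
  · subst e
    have e1 := filter_le_max'_eq hR le_rfl (fun w _ hw => hw) h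
    have e2 := filter_ge_min'_eq hR le_rfl (fun w _ hw => hw) h'
    simp only [e1, e2, if_true]
    field_simp
    ring
  have e1 := filter_le_max'_eq hL hLr
    (fun w hw hwr => (hgap w hw).resolve_right (by intro; linarith)) h
  have e2 := filter_ge_min'_eq hR hrR
    (fun w hw hwr => (hgap w hw).resolve_left (by intro; linarith)) h'
  simp only [e1, e2, hLR.ne, if_false]

lemma harmonicExp_of_le_right {F : Finset ℝ} {r L : ℝ} (φ : ℝ → ℝ) (hL : L ∈ F) (hLr : L ≤ r)
    (hgap : ∀ w ∈ F, w ≤ L) : harmonicExp F r φ = φ L := by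
  have h : (F.filter (fun w => w ≤ r)).Nonempty := ⟨L, Finset.mem_filter.2 ⟨hL, hLr⟩⟩
  have e1 := filter_le_max'_eq hL hLr (fun w hw _ => hgap w hw) h
  rw [harmonicExp, dif_pos h]
  split_ifs with h'
  · obtain ⟨w, hw⟩ := id h'
    rw [Finset.mem_filter] at hw
    have hr : r = L := le_antisymm (hw.2.trans (hgap w hw.1)) hLr
    have e2 := filter_ge_min'_eq hL hr.le (fun w _ hw => hr ▸ hw) h'
    simp only [e1, e2, if_true]
  · rw [e1]

lemma harmonicExp_of_le_left {F : Finset ℝ} {r R : ℝ} (φ : ℝ → ℝ) (hR : R ∈ F) (hrR : r ≤ R)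
    (hgap : ∀ w ∈ F, R ≤ w) : harmonicExp F r φ = φ R := by
  have h' : (F.filter (fun w => r ≤ w)).Nonempty := ⟨R, Finset.mem_filter.2 ⟨hR, hrR⟩⟩
  have e2 := filter_ge_min'_eq hR hrR (fun w hw _ => hgap w hw) h'
  rw [harmonicExp]
  split_ifs with h
  · obtain ⟨w, hw⟩ := id h
    rw [Finset.mem_filter] at hw
    have hr : r = R := le_antisymm hrR ((hgap w hw.1).trans hw.2)
    have e1 := filter_le_max'_eq hR hr.ge (fun w _ hw => hr ▸ hw) h
    simp only [e1, e2, if_true]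
  · rw [e2]

lemma exists_greatest_le {F : Finset ℝ} {r : ℝ} (h : ∃ w ∈ F, w ≤ r) :
    ∃ L ∈ F, L ≤ r ∧ ∀ w ∈ F, w ≤ r → w ≤ L := by
  obtain ⟨w, hw, hwr⟩ := h
  have hne : (F.filter (fun w => w ≤ r)).Nonempty := ⟨w, Finset.mem_filter.2 ⟨hw, hwr⟩⟩
  have := Finset.mem_filter.1 (Finset.max'_mem _ hne)
  exact ⟨_, this.1, this.2, fun w hw hwr => Finset.le_max' _ _ (Finset.mem_filter.2 ⟨hw, hwr⟩)⟩

lemma exists_least_ge {F : Finset ℝ} {r : ℝ} (h : ∃ w ∈ F, r ≤ w) :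
    ∃ R ∈ F, r ≤ R ∧ ∀ w ∈ F, r ≤ w → R ≤ w := by
  obtain ⟨w, hw, hwr⟩ := h
  have hne : (F.filter (fun w => r ≤ w)).Nonempty := ⟨w, Finset.mem_filter.2 ⟨hw, hwr⟩⟩
  have := Finset.mem_filter.1 (Finset.min'_mem _ hne)
  exact ⟨_, this.1, this.2, fun w hw hwr => Finset.min'_le _ _ (Finset.mem_filter.2 ⟨hw, hwr⟩)⟩

/-- The position of `r` relative to a nonempty finite set. -/
lemma neighbours_cases {F : Finset ℝ} (hF : F.Nonempty) (r : ℝ) :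
    (∃ L ∈ F, ∃ R ∈ F, L < R ∧ L ≤ r ∧ r ≤ R ∧ ∀ w ∈ F, w ≤ L ∨ R ≤ w) ∨
    (∃ L ∈ F, L ≤ r ∧ ∀ w ∈ F, w ≤ L) ∨ (∃ R ∈ F, r ≤ R ∧ ∀ w ∈ F, R ≤ w) := by
  by_cases h1 : ∃ w ∈ F, w ≤ r
  · obtain ⟨L, hL, hLr, hmax⟩ := exists_greatest_le h1
    by_cases h2 : ∃ w ∈ F, r < w
    · obtain ⟨w, hw, hrw⟩ := h2
      -- The right neighbour is taken strictly beyond `r`, so that `L < R` even when `r ∈ F`.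
      have hne : (F.filter (fun w => r < w)).Nonempty := ⟨w, Finset.mem_filter.2 ⟨hw, hrw⟩⟩
      have hm := Finset.mem_filter.1 (Finset.min'_mem _ hne)
      refine Or.inl ⟨L, hL, _, hm.1, hLr.trans_lt hm.2, hLr, hm.2.le, fun z hz => ?_⟩
      rcases le_or_gt z r with h | h
      · exact Or.inl (hmax z hz h)
      · exact Or.inr (Finset.min'_le _ _ (Finset.mem_filter.2 ⟨hz, h⟩))
    · push Not at h2
      exact Or.inr (Or.inl ⟨L, hL, hLr, fun w hw => hmax w hw (h2 w hw)⟩)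
  · push Not at h1
    obtain ⟨w, hw⟩ := hF
    obtain ⟨R, hR, hrR, hmin⟩ := exists_least_ge ⟨w, hw, (h1 w hw).le⟩
    exact Or.inr (Or.inr ⟨R, hR, hrR, fun w hw => hmin w hw (h1 w hw).le⟩)

/-! ### The harmonic algorithm and the inequalities for one request. -/

/-- The expected cost of serving the request `r` harmonically from the free set `F`, when `V`
is the cost of continuing with the remaining free set. -/
noncomputable def harmonicStep (r : ℝ) (V : Finset ℝ → ℝ) (F : Finset ℝ) : ℝ :=
  harmonicExp F r (fun w => |r - w| + V (F.erase w))

/-- The expected cost of serving a list of requests harmonically from the free set `F`. -/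
noncomputable def harmonicCost (rs : List ℝ) : Finset ℝ → ℝ :=
  rs.foldr harmonicStep (fun _ => 0)

/-- `V` changes by at most `(v - u) * ψ (v - u)` when one free point moves from `u` to `v`, with no
free point in between; all points lie in an interval of length `K`. -/
def AdjacentBound (K : ℝ) (V : Finset ℝ → ℝ) (ψ : ℝ → ℝ) : Prop :=
  ∀ (F : Finset ℝ) (u v : ℝ), u < v → (∀ w ∈ F, w < u ∨ v < w) →
    (∀ p ∈ insert u (insert v F), ∀ q ∈ insert u (insert v F), q - p ≤ K) →
    |V (insert u F) - V (insert v F)| ≤ (v - u) * ψ (v - u)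

/-- Couple the runs from `insert u F` and `insert v F`, with `s` the left neighbour of both. Either
both take `s` (values `VAs`, `VBs`), or they take `u` and `v` (both leave `F`, value `VF`), or the
first takes `u` and the second `s`. The last event widens the gap to `v - s`; its probability is at
most `(v - u) / (v - s)`, which keeps the bound proportional to `v - u`. -/
lemma abs_sub_le_of_request_left {s r u v VAs VBs VF p0 p0' p1 : ℝ} (hsu : s < u) (huv : u < v)
    (hsr : s ≤ r) (hru : r ≤ u) (h1 : |VAs - VBs| ≤ (v - u) * p0)
    (h2 : |VF - VBs| ≤ (v - s) * p0') (hp : p0 ≤ p1)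
    (hp' : p0' + 2 * ((v - s) - (v - u)) / (v - s) ≤ p1) :
    |((u - r) * ((r - s) + VAs) + (r - s) * ((u - r) + VF)) / (u - s) -
      ((v - r) * ((r - s) + VBs) + (r - s) * ((v - r) + VF)) / (v - s)| ≤ (v - u) * p1 := by
  have hus : 0 < u - s := by linarith
  have hvs : 0 < v - s := by linarith
  have hvu : 0 < v - u := by linarith
  have ha : 0 ≤ r - s := by linarith
  have hb : 0 ≤ u - r := by linarith
  have key : ((u - r) * ((r - s) + VAs) + (r - s) * ((u - r) + VF)) / (u - s) -
      ((v - r) * ((r - s) + VBs) + (r - s) * ((v - r) + VF)) / (v - s) =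
      (u - r) / (u - s) * (VAs - VBs) +
      (r - s) * (v - u) / ((u - s) * (v - s)) * ((VF - VBs) - 2 * (r - s)) := by
    field_simp
    ring
  have hq : 0 ≤ (r - s) * (v - u) / ((u - s) * (v - s)) := by positivity
  have hρ : 0 ≤ (u - r) / (u - s) := by positivity
  have h3 : |(VF - VBs) - 2 * (r - s)| ≤ (v - s) * p1 := by
    have e : (v - s) * (2 * ((v - s) - (v - u)) / (v - s)) = 2 * (u - s) := by
      field_simp
      ring
    have := mul_le_mul_of_nonneg_left hp' hvs.le
    rw [mul_add, e] at this
    rw [abs_le] at h2 ⊢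
    constructor <;> linarith [h2.1, h2.2]
  have h4 : |VAs - VBs| ≤ (v - u) * p1 := h1.trans (by gcongr)
  rw [key]
  calc _ ≤ (u - r) / (u - s) * |VAs - VBs| +
      (r - s) * (v - u) / ((u - s) * (v - s)) * |(VF - VBs) - 2 * (r - s)| := by
        refine (abs_add_le _ _).trans ?_
        rw [abs_mul, abs_mul, abs_of_nonneg hq, abs_of_nonneg hρ]
    _ ≤ (u - r) / (u - s) * ((v - u) * p1) +
      (r - s) * (v - u) / ((u - s) * (v - s)) * ((v - s) * p1) := by gcongr
    _ = (v - u) * p1 := by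
      field_simp
      ring

/-- Here `x / E` is the probability of widening the gap to `E`. The recurrence for `ψ` leaves the
slack `2 * x * (E - D) / E`, which absorbs the difference in distances. -/
lemma mul_div_bound {x D E Y p0 p1 : ℝ} (hx : 0 ≤ x) (hE : 0 < E)
    (hY : |Y| ≤ E * p0) (hp : p0 + 2 * (E - D) / E ≤ p1) :
    |x / E * Y| ≤ x * p1 - 2 * x * (E - D) / E := by
  rw [abs_mul, abs_of_nonneg (by positivity)]
  calc x / E * |Y| ≤ x / E * (E * p0) := by gcongr
    _ = x * p0 := by field_simp
    _ ≤ x * (p1 - 2 * (E - D) / E) := by gcongr; linarith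
    _ = _ := by ring

/-- Both runs are compared with `VF`, the value after taking `u` or `v`. They avoid that outcome
with probabilities `(r - u) / (t - u)` and `(v - r) / (v - s)`. As `(r - u) + (v - r) = v - u`, the
main terms add up to `(v - u) * p1`, and the slacks of `mul_div_bound` dominate the distance terms.
-/
lemma abs_sub_le_of_request_between {s r u v t VAt VBs VF p0 p0' p1 : ℝ} (hsu : s < u)
    (hvt : v < t) (hur : u < r) (hrv : r < v) (h1 : |VAt - VF| ≤ (t - u) * p0)
    (h2 : |VF - VBs| ≤ (v - s) * p0')
    (hp : p0 + 2 * ((t - u) - (v - u)) / (t - u) ≤ p1)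
    (hp' : p0' + 2 * ((v - s) - (v - u)) / (v - s) ≤ p1) :
    |((t - r) * ((r - u) + VF) + (r - u) * ((t - r) + VAt)) / (t - u) -
      ((v - r) * ((r - s) + VBs) + (r - s) * ((v - r) + VF)) / (v - s)| ≤ (v - u) * p1 := by
  have hE : 0 < t - u := by linarith
  have hE' : 0 < v - s := by linarith
  have hD : 0 < v - u := by linarith
  have hx : 0 < r - u := by linarith
  have hy : 0 < v - r := by linarith
  have b1 := mul_div_bound hx.le hE h1 hp
  have b2 := mul_div_bound hy.le hE' h2 hp'
  have key : ((t - r) * ((r - u) + VF) + (r - u) * ((t - r) + VAt)) / (t - u) -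
      ((v - r) * ((r - s) + VBs) + (r - s) * ((v - r) + VF)) / (v - s) =
      (r - u) / (t - u) * (VAt - VF) + (v - r) / (v - s) * (VF - VBs) +
      (2 * (r - u) * ((t - u) - (v - u)) / (t - u) * ((r - u) / (v - u)) -
       2 * (v - r) * ((v - s) - (v - u)) / (v - s) * ((v - r) / (v - u))) := by
    field_simp
    ring
  have c1 : 0 ≤ 2 * (r - u) * ((t - u) - (v - u)) / (t - u) := by
    apply div_nonneg _ hE.le
    apply mul_nonneg <;> linarith
  have c2 : 0 ≤ 2 * (v - r) * ((v - s) - (v - u)) / (v - s) := by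
    apply div_nonneg _ hE'.le
    apply mul_nonneg <;> linarith
  have f1 : (r - u) / (v - u) ≤ 1 := by rw [div_le_one hD]; linarith
  have f2 : (v - r) / (v - u) ≤ 1 := by rw [div_le_one hD]; linarith
  have d1 := mul_le_of_le_one_right c1 f1
  have d2 := mul_le_of_le_one_right c2 f2
  have e1 := mul_nonneg c1 (by positivity : 0 ≤ (r - u) / (v - u))
  have e2 := mul_nonneg c2 (by positivity : 0 ≤ (v - r) / (v - u))
  rw [key]
  rw [abs_le] at b1 b2 ⊢
  constructor <;> nlinarith [b1.1, b1.2, b2.1, b2.2]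

/-- The variant without a free point right of `v`: one run must take `u`, and `1 ≤ p1` pays for its
distance `r - u`. -/
lemma abs_sub_le_of_request_between_left {s r u v VBs VF p0' p1 : ℝ} (hsu : s < u)
    (hur : u < r) (hrv : r < v)
    (h2 : |VF - VBs| ≤ (v - s) * p0') (h1 : 1 ≤ p1)
    (hp' : p0' + 2 * ((v - s) - (v - u)) / (v - s) ≤ p1) :
    |((r - u) + VF) -
      ((v - r) * ((r - s) + VBs) + (r - s) * ((v - r) + VF)) / (v - s)| ≤ (v - u) * p1 := by
  have hE' : 0 < v - s := by linarith
  have hD : 0 < v - u := by linarith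
  have hx : 0 < r - u := by linarith
  have hy : 0 < v - r := by linarith
  have b2 := mul_div_bound hy.le hE' h2 hp'
  have key : ((r - u) + VF) -
      ((v - r) * ((r - s) + VBs) + (r - s) * ((v - r) + VF)) / (v - s) =
      (v - r) / (v - s) * (VF - VBs) +
      ((r - u) - 2 * ((r - u) * ((v - r) / (v - u))) -
       2 * (v - r) * ((v - s) - (v - u)) / (v - s) * ((v - r) / (v - u))) := by
    field_simp
    ring
  have c2 : 0 ≤ 2 * (v - r) * ((v - s) - (v - u)) / (v - s) := by
    apply div_nonneg _ hE'.le
    apply mul_nonneg <;> linarith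
  have f2 : (v - r) / (v - u) ≤ 1 := by rw [div_le_one hD]; linarith
  have f3 : 0 ≤ (v - r) / (v - u) := by positivity
  have d2 := mul_le_of_le_one_right c2 f2
  have e2 := mul_nonneg c2 f3
  have d3 := mul_le_of_le_one_right hx.le f2
  have e3 := mul_nonneg hx.le f3
  have g : (r - u) ≤ (r - u) * p1 := by nlinarith
  rw [key]
  rw [abs_le] at b2 ⊢
  constructor <;> nlinarith [b2.1, b2.2]

/-! ### Reflection symmetry, which reduces requests right of `v` to requests left of `u`. -/

lemma harmonicExp_neg (F : Finset ℝ) (r : ℝ) (φ : ℝ → ℝ) :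
    harmonicExp (F.image (fun w => -w)) (-r) φ = harmonicExp F r (fun w => φ (-w)) := by
  rcases F.eq_empty_or_nonempty with rfl | hF
  · simp [harmonicExp]
  have mem : ∀ {w}, w ∈ F → -w ∈ F.image (fun w => -w) := fun h => Finset.mem_image_of_mem _ h
  rcases neighbours_cases hF r with ⟨L, hL, R, hR, hLR, hLr, hrR, hg⟩ | ⟨L, hL, hLr, hg⟩ |
    ⟨R, hR, hrR, hg⟩
  · rw [harmonicExp_between _ hL hR hLR hLr hrR hg,
      harmonicExp_between φ (mem hR) (mem hL) (by linarith) (by linarith) (by linarith)]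
    · congr 1 <;> ring
    · intro w hw
      obtain ⟨z, hz, rfl⟩ := Finset.mem_image.1 hw
      rcases hg z hz with h | h
      · exact Or.inr (by linarith)
      · exact Or.inl (by linarith)
  · rw [harmonicExp_of_le_right _ hL hLr hg,
      harmonicExp_of_le_left φ (mem hL) (by linarith)]
    intro w hw
    obtain ⟨z, hz, rfl⟩ := Finset.mem_image.1 hw
    linarith [hg z hz]
  · rw [harmonicExp_of_le_left _ hR hrR hg,
      harmonicExp_of_le_right φ (mem hR) (by linarith)]
    intro w hw
    obtain ⟨z, hz, rfl⟩ := Finset.mem_image.1 hw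
    linarith [hg z hz]

lemma image_neg_neg (F : Finset ℝ) : (F.image (fun w => -w)).image (fun w => -w) = F := by
  simp [Finset.image_image]

lemma harmonicStep_neg (r : ℝ) (V : Finset ℝ → ℝ) (F : Finset ℝ) :
    harmonicStep (-r) (fun F => V (F.image (fun w => -w))) (F.image (fun w => -w)) =
      harmonicStep r V F := by
  rw [harmonicStep, harmonicExp_neg, harmonicStep]
  congr 1
  funext w
  congr 1
  · rw [← abs_neg]; ring_nf
  · congr 1
    rw [Finset.image_erase neg_injective, image_neg_neg, neg_neg]

lemma AdjacentBound.neg {K : ℝ} {V : Finset ℝ → ℝ} {ψ : ℝ → ℝ} (h : AdjacentBound K V ψ) :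
    AdjacentBound K (fun F => V (F.image (fun w => -w))) ψ := by
  intro F u v huv hg hK
  have := h (F.image (fun w => -w)) (-v) (-u) (by linarith) ?_ ?_
  · simp only [Finset.image_insert]
    rw [abs_sub_comm]
    convert this using 2 <;> ring_nf
  · intro w hw
    obtain ⟨z, hz, rfl⟩ := Finset.mem_image.1 hw
    rcases hg z hz with h | h
    · exact Or.inr (by linarith)
    · exact Or.inl (by linarith)
  · have key : ∀ p ∈ insert (-v) (insert (-u) (F.image (fun w => -w))),
        -p ∈ insert u (insert v F) := by
      intro p hp
      simp only [Finset.mem_insert, Finset.mem_image] at hp ⊢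
      rcases hp with rfl | rfl | ⟨z, hz, rfl⟩ <;> simp [*]
    intro p hp q hq
    linarith [hK _ (key q hq) _ (key p hp)]

/-! ### Sensitivity of the cost to moving one free point. -/

section Discrepancy

variable {K : ℝ} {V : Finset ℝ → ℝ} {ψ₀ ψ₁ : ℝ → ℝ}

lemma bound_mono (hψ : ∀ D E, 0 < D → D ≤ E → ψ₀ E + 2 * (E - D) / E ≤ ψ₁ D) {D : ℝ}
    (hD : 0 < D) : ψ₀ D ≤ ψ₁ D := by
  simpa using hψ D D hD le_rfl

lemma erase_insert_self_of_gap {F : Finset ℝ} {u v : ℝ} (hg : ∀ w ∈ F, w < u ∨ v < w)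
    (huv : u < v) : (insert u F).erase u = F ∧ (insert v F).erase v = F := by
  constructor <;> refine Finset.erase_insert fun h => ?_
  · rcases hg u h with h | h <;> linarith
  · rcases hg v h with h | h <;> linarith

/-- Moving the free point `u` to `v` when another point `w` has been taken. -/
lemma AdjacentBound.erase (hV : AdjacentBound K V ψ₀) {F : Finset ℝ} {u v w : ℝ} (huv : u < v)
    (hg : ∀ w ∈ F, w < u ∨ v < w)
    (hK : ∀ p ∈ insert u (insert v F), ∀ q ∈ insert u (insert v F), q - p ≤ K) (hw : w ∈ F) :
    |V ((insert u F).erase w) - V ((insert v F).erase w)| ≤ (v - u) * ψ₀ (v - u) := by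
  have hu : u ≠ w := by rintro rfl; rcases hg u hw with h | h <;> linarith
  have hv : v ≠ w := by rintro rfl; rcases hg v hw with h | h <;> linarith
  rw [Finset.erase_insert_of_ne hu, Finset.erase_insert_of_ne hv]
  have hsub : insert u (insert v (F.erase w)) ⊆ insert u (insert v F) :=
    Finset.insert_subset_insert _ (Finset.insert_subset_insert _ (Finset.erase_subset _ _))
  exact hV _ u v huv (fun z hz => hg z (Finset.mem_of_mem_erase hz))
    (fun p hp q hq => hK p (hsub hp) q (hsub hq))

/-- The free point `v` moves to the left neighbour `s` of `u`. -/
lemma AdjacentBound.erase_left (hV : AdjacentBound K V ψ₀) {F : Finset ℝ} {s u v : ℝ}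
    (huv : u < v) (hg : ∀ w ∈ F, w < u ∨ v < w)
    (hK : ∀ p ∈ insert u (insert v F), ∀ q ∈ insert u (insert v F), q - p ≤ K) (hs : s ∈ F)
    (hsu : s < u) (hsg : ∀ w ∈ F, w ≤ s ∨ v < w) :
    |V F - V ((insert v F).erase s)| ≤ (v - s) * ψ₀ (v - s) := by
  have hv : v ≠ s := by linarith
  rw [Finset.erase_insert_of_ne hv]
  have hsub : insert s (insert v (F.erase s)) ⊆ insert u (insert v F) := by
    intro z hz
    simp only [Finset.mem_insert, Finset.mem_erase] at hz ⊢
    rcases hz with rfl | rfl | hz <;> tauto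
  have := hV (F.erase s) s v (by linarith) (fun z hz => ?_)
    (fun p hp q hq => hK p (hsub hp) q (hsub hq))
  · rwa [Finset.insert_erase hs] at this
  · rw [Finset.mem_erase] at hz
    exact (hsg z hz.2).imp_left fun h => lt_of_le_of_ne h hz.1

/-- The free point `u` moves to the right neighbour `t` of `v`. -/
lemma AdjacentBound.erase_right (hV : AdjacentBound K V ψ₀) {F : Finset ℝ} {u v t : ℝ}
    (huv : u < v) (hg : ∀ w ∈ F, w < u ∨ v < w)
    (hK : ∀ p ∈ insert u (insert v F), ∀ q ∈ insert u (insert v F), q - p ≤ K) (ht : t ∈ F)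
    (hvt : v < t) (htg : ∀ w ∈ F, w < u ∨ t ≤ w) :
    |V ((insert u F).erase t) - V F| ≤ (t - u) * ψ₀ (t - u) := by
  have hu : u ≠ t := by linarith
  rw [Finset.erase_insert_of_ne hu]
  have hsub : insert u (insert t (F.erase t)) ⊆ insert u (insert v F) := by
    intro z hz
    simp only [Finset.mem_insert, Finset.mem_erase] at hz ⊢
    rcases hz with rfl | rfl | hz <;> tauto
  have := hV (F.erase t) u t (by linarith) (fun z hz => ?_)
    (fun p hp q hq => hK p (hsub hp) q (hsub hq))
  · rwa [Finset.insert_erase ht] at this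
  · rw [Finset.mem_erase] at hz
    exact (htg z hz.2).imp_right fun h => lt_of_le_of_ne h (Ne.symm hz.1)

lemma AdjacentBound.step_of_le (hV : AdjacentBound K V ψ₀)
    (hψ : ∀ D E, 0 < D → D ≤ E → ψ₀ E + 2 * (E - D) / E ≤ ψ₁ D)
    (hψ' : ∀ D, 0 < D → D ≤ K → 1 ≤ ψ₁ D) {F : Finset ℝ} {r u v : ℝ} (huv : u < v)
    (hg : ∀ w ∈ F, w < u ∨ v < w)
    (hK : ∀ p ∈ insert u (insert v F), ∀ q ∈ insert u (insert v F), q - p ≤ K) (hru : r ≤ u) :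
    |harmonicStep r V (insert u F) - harmonicStep r V (insert v F)| ≤ (v - u) * ψ₁ (v - u) := by
  have hD : 0 < v - u := by linarith
  have h1 : 1 ≤ ψ₁ (v - u) := hψ' _ hD (hK u (by simp) v (by simp))
  obtain ⟨eu, ev⟩ := erase_insert_self_of_gap hg huv
  by_cases hs : ∃ w ∈ F, w ≤ u
  swap
  -- Without a free point left of `u`, the runs must take `u` and `v`; both leave `F` and the costs
  -- differ by exactly `v - u`, whence the need for `1 ≤ ψ₁`.
  · push Not at hs
    have hg' : ∀ w ∈ F, v < w := fun w hw => (hg w hw).resolve_left (hs w hw).not_gt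
    rw [harmonicStep, harmonicStep,
      harmonicExp_of_le_left (R := u) _ (by simp) hru (by
        intro w hw
        rcases Finset.mem_insert.1 hw with rfl | hw
        · exact le_rfl
        · exact (hs w hw).le),
      harmonicExp_of_le_left (R := v) _ (by simp) (by linarith) (by
        intro w hw
        rcases Finset.mem_insert.1 hw with rfl | hw
        · exact le_rfl
        · exact (hg' w hw).le),
      eu, ev, abs_of_nonpos (by linarith : r - u ≤ 0), abs_of_nonpos (by linarith : r - v ≤ 0),
      abs_le]
    constructor <;> nlinarith
  obtain ⟨s, hsF, hsu, hmax⟩ := exists_greatest_le hs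
  have hsu : s < u := (hg s hsF).resolve_right (by intro; linarith)
  have hsg : ∀ w ∈ F, w ≤ s ∨ v < w := fun w hw =>
    (hg w hw).imp_left fun h => hmax w hw h.le
  have hs0 := hV.erase huv hg hK hsF
  by_cases hsr : s ≤ r
  · rw [harmonicStep, harmonicStep,
      harmonicExp_between (L := s) (R := u) _ (by simp [hsF]) (by simp) hsu hsr hru (by
        intro w hw
        rcases Finset.mem_insert.1 hw with rfl | hw
        · exact Or.inr le_rfl
        · exact (hsg w hw).imp_right fun h => by linarith),
      harmonicExp_between (L := s) (R := v) _ (by simp [hsF]) (by simp) (by linarith) hsr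
        (by linarith) (by
        intro w hw
        rcases Finset.mem_insert.1 hw with rfl | hw
        · exact Or.inr le_rfl
        · exact (hsg w hw).imp_right le_of_lt),
      eu, ev, abs_of_nonneg (by linarith : 0 ≤ r - s), abs_sub_comm r u, abs_sub_comm r v,
      abs_of_nonneg (by linarith : 0 ≤ u - r), abs_of_nonneg (by linarith : 0 ≤ v - r)]
    exact abs_sub_le_of_request_left hsu huv hsr hru hs0
      (hV.erase_left huv hg hK hsF hsu hsg) (bound_mono hψ hD) (hψ _ _ hD (by linarith))
  · push Not at hsr
    -- For `r < s` both runs have the same neighbours of `r` and make the same choice; the gap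
    -- between `u` and `v` persists unchanged.
    have hmono : (v - u) * ψ₀ (v - u) ≤ (v - u) * ψ₁ (v - u) := by
      gcongr
      exact bound_mono hψ hD
    by_cases hl : ∃ w ∈ F, w ≤ r
    · obtain ⟨L, hL, hLr, hLmax⟩ := exists_greatest_le hl
      obtain ⟨R, hR, hrR, hRmin⟩ := exists_least_ge ⟨s, hsF, hsr.le⟩
      have hRs : R ≤ s := hRmin s hsF hsr.le
      have hgap : ∀ w ∈ F, w ≤ L ∨ R ≤ w := fun w hw =>
        (le_total w r).imp (hLmax w hw) (hRmin w hw)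
      rcases eq_or_lt_of_le (hLr.trans hrR) with e | hLR
      · have hrL : r = L := le_antisymm (e ▸ hrR) hLr
        subst hrL
        -- Here `r` is itself free and is taken surely; `R'` only serves to apply the interpolation
        -- formula and gets weight zero.
        obtain ⟨R', hR', hR'min⟩ : ∃ R' ∈ F.filter (fun w => r < w),
            ∀ w ∈ F.filter (fun w => r < w), R' ≤ w :=
          ⟨_, Finset.min'_mem _ ⟨s, Finset.mem_filter.2 ⟨hsF, hsr⟩⟩,
            fun w hw => Finset.min'_le _ _ hw⟩
        rw [Finset.mem_filter] at hR'
        have hR's : R' ≤ s := hR'min s (Finset.mem_filter.2 ⟨hsF, hsr⟩)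
        have aux : ∀ z, s ≤ z → ∀ w ∈ insert z F, w ≤ r ∨ R' ≤ w := by
          intro z hz w hw
          rcases Finset.mem_insert.1 hw with rfl | hw
          · right; linarith
          · exact (le_or_gt w r).imp_right fun h => hR'min w (Finset.mem_filter.2 ⟨hw, h⟩)
        rw [harmonicStep, harmonicStep,
          harmonicExp_between (L := r) (R := R') _ (by simp [hL]) (by simp [hR'.1]) hR'.2 le_rfl
            hR'.2.le (aux u hsu.le),
          harmonicExp_between (L := r) (R := R') _ (by simp [hL]) (by simp [hR'.1]) hR'.2 le_rfl
            hR'.2.le (aux v (by linarith))]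
        have hne : R' - r ≠ 0 := by linarith [hR'.2]
        have := hV.erase huv hg hK hL
        simp only [sub_self, zero_mul, add_zero, mul_div_cancel_left₀ _ hne]
        rw [add_sub_add_left_eq_sub]
        exact this.trans hmono
      · have aux : ∀ z, s ≤ z → ∀ w ∈ insert z F, w ≤ L ∨ R ≤ w := by
          intro z hz w hw
          rcases Finset.mem_insert.1 hw with rfl | hw
          · right; linarith
          · exact hgap w hw
        rw [harmonicStep, harmonicStep,
          harmonicExp_between _ (by simp [hL]) (by simp [hR]) hLR hLr hrR (aux u hsu.le),
          harmonicExp_between _ (by simp [hL]) (by simp [hR]) hLR hLr hrR (aux v (by linarith))]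
        have eL := (hV.erase huv hg hK hL).trans hmono
        have eR := (hV.erase huv hg hK hR).trans hmono
        have hpos : 0 < R - L := by linarith
        rw [← sub_div, abs_div, abs_of_pos hpos, div_le_iff₀ hpos]
        rw [abs_le] at eL eR ⊢
        have a : 0 ≤ R - r := by linarith
        have b : 0 ≤ r - L := by linarith
        constructor <;>
          nlinarith [mul_le_mul_of_nonneg_left eL.1 a, mul_le_mul_of_nonneg_left eL.2 a,
            mul_le_mul_of_nonneg_left eR.1 b, mul_le_mul_of_nonneg_left eR.2 b]
    · push Not at hl
      obtain ⟨R, hR, hrR, hRmin⟩ := exists_least_ge ⟨s, hsF, hsr.le⟩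
      have hRs : R ≤ s := hRmin s hsF hsr.le
      have aux : ∀ z, s ≤ z → ∀ w ∈ insert z F, R ≤ w := by
        intro z hz w hw
        rcases Finset.mem_insert.1 hw with rfl | hw
        · linarith
        · exact hRmin w hw (hl w hw).le
      rw [harmonicStep, harmonicStep,
        harmonicExp_of_le_left _ (by simp [hR]) hrR (aux u hsu.le),
        harmonicExp_of_le_left _ (by simp [hR]) hrR (aux v (by linarith)),
        add_sub_add_left_eq_sub]
      exact (hV.erase huv hg hK hR).trans hmono

lemma AdjacentBound.step_of_between (hV : AdjacentBound K V ψ₀)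
    (hψ : ∀ D E, 0 < D → D ≤ E → ψ₀ E + 2 * (E - D) / E ≤ ψ₁ D)
    (hψ' : ∀ D, 0 < D → D ≤ K → 1 ≤ ψ₁ D) {F : Finset ℝ} {r u v : ℝ}
    (hg : ∀ w ∈ F, w < u ∨ v < w)
    (hK : ∀ p ∈ insert u (insert v F), ∀ q ∈ insert u (insert v F), q - p ≤ K)
    (hur : u < r) (hrv : r < v) :
    |harmonicStep r V (insert u F) - harmonicStep r V (insert v F)| ≤ (v - u) * ψ₁ (v - u) := by
  have huv : u < v := hur.trans hrv
  have hD : 0 < v - u := by linarith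
  have h1 : 1 ≤ ψ₁ (v - u) := hψ' _ hD (hK u (by simp) v (by simp))
  obtain ⟨eu, ev⟩ := erase_insert_self_of_gap hg huv
  have evalA : ∀ t ∈ F, v < t → (∀ w ∈ F, w < u ∨ t ≤ w) → harmonicStep r V (insert u F) =
      ((t - r) * ((r - u) + V F) + (r - u) * ((t - r) + V ((insert u F).erase t))) / (t - u) := by
    intro t ht hvt htg
    rw [harmonicStep, harmonicExp_between (L := u) (R := t) _ (by simp) (by simp [ht])
      (by linarith) hur.le (by linarith) (by
        intro w hw
        rcases Finset.mem_insert.1 hw with rfl | hw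
        · exact Or.inl le_rfl
        · exact (htg w hw).imp_left le_of_lt),
      eu, abs_of_nonneg (by linarith : 0 ≤ r - u), abs_sub_comm r t,
      abs_of_nonneg (by linarith : 0 ≤ t - r)]
  have evalB : ∀ s ∈ F, s < u → (∀ w ∈ F, w ≤ s ∨ v < w) → harmonicStep r V (insert v F) =
      ((v - r) * ((r - s) + V ((insert v F).erase s)) + (r - s) * ((v - r) + V F)) / (v - s) := by
    intro s hs hsu hsg
    rw [harmonicStep, harmonicExp_between (L := s) (R := v) _ (by simp [hs]) (by simp)
      (by linarith) (by linarith) hrv.le (by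
        intro w hw
        rcases Finset.mem_insert.1 hw with rfl | hw
        · exact Or.inr le_rfl
        · exact (hsg w hw).imp_right le_of_lt),
      ev, abs_of_nonneg (by linarith : 0 ≤ r - s), abs_sub_comm r v,
      abs_of_nonneg (by linarith : 0 ≤ v - r)]
  have evalA' : (∀ w ∈ F, w < u) → harmonicStep r V (insert u F) = (r - u) + V F := by
    intro h
    rw [harmonicStep, harmonicExp_of_le_right (L := u) _ (by simp) hur.le (by
        intro w hw
        rcases Finset.mem_insert.1 hw with rfl | hw
        · exact le_rfl
        · exact (h w hw).le), eu, abs_of_nonneg (by linarith : 0 ≤ r - u)]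
  have evalB' : (∀ w ∈ F, v < w) → harmonicStep r V (insert v F) = (v - r) + V F := by
    intro h
    rw [harmonicStep, harmonicExp_of_le_left (R := v) _ (by simp) hrv.le (by
        intro w hw
        rcases Finset.mem_insert.1 hw with rfl | hw
        · exact le_rfl
        · exact (h w hw).le), ev, abs_sub_comm, abs_of_nonneg (by linarith : 0 ≤ v - r)]
  by_cases hs : ∃ w ∈ F, w ≤ u
  · obtain ⟨s, hsF, hsu, hmax⟩ := exists_greatest_le hs
    have hsu : s < u := (hg s hsF).resolve_right (by intro; linarith)
    have hsg : ∀ w ∈ F, w ≤ s ∨ v < w := fun w hw =>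
      (hg w hw).imp_left fun h => hmax w hw h.le
    rw [evalB s hsF hsu hsg]
    have bs := hV.erase_left huv hg hK hsF hsu hsg
    by_cases ht : ∃ w ∈ F, v ≤ w
    · obtain ⟨t, htF, hvt, hmin⟩ := exists_least_ge ht
      have hvt : v < t := (hg t htF).resolve_left (by intro; linarith)
      have htg : ∀ w ∈ F, w < u ∨ t ≤ w := fun w hw =>
        (hg w hw).imp_right fun h => hmin w hw h.le
      rw [evalA t htF hvt htg]
      exact abs_sub_le_of_request_between hsu hvt hur hrv
        (hV.erase_right huv hg hK htF hvt htg) bs (hψ _ _ hD (by linarith))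
        (hψ _ _ hD (by linarith))
    · push Not at ht
      rw [evalA' fun w hw => (hg w hw).resolve_right (ht w hw).not_gt]
      exact abs_sub_le_of_request_between_left hsu hur hrv bs h1 (hψ _ _ hD (by linarith))
  · push Not at hs
    rw [evalB' fun w hw => (hg w hw).resolve_left (hs w hw).not_gt]
    by_cases ht : ∃ w ∈ F, v ≤ w
    · obtain ⟨t, htF, hvt, hmin⟩ := exists_least_ge ht
      have hvt : v < t := (hg t htF).resolve_left (by intro; linarith)
      have htg : ∀ w ∈ F, w < u ∨ t ≤ w := fun w hw =>
        (hg w hw).imp_right fun h => hmin w hw h.le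
      rw [evalA t htF hvt htg, abs_sub_comm]
      have h2 := hV.erase_right huv hg hK htF hvt htg
      rw [abs_sub_comm] at h2
      -- Mirror image of the case without a right neighbour: `t` plays the role of `s`.
      have := abs_sub_le_of_request_between_left (s := -t) (r := -r) (u := -v) (v := -u)
        (VBs := V ((insert u F).erase t)) (VF := V F) (p0' := ψ₀ (t - u)) (p1 := ψ₁ (v - u))
        (by linarith) (by linarith) (by linarith) (by convert h2 using 2; ring) h1 (by
          convert hψ _ _ hD (by linarith : v - u ≤ t - u) using 3 <;> ring)
      convert this using 2
      · congr 1
        · ring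
        · congr 1 <;> ring
      · ring
    · push Not at ht
      rw [evalA' fun w hw => (hg w hw).resolve_right (ht w hw).not_gt, abs_le]
      constructor <;> nlinarith

/-- One harmonic step preserves the bound for moving a free point, with a slightly worse
function `ψ`. -/
lemma AdjacentBound.step (hV : AdjacentBound K V ψ₀)
    (hψ : ∀ D E, 0 < D → D ≤ E → ψ₀ E + 2 * (E - D) / E ≤ ψ₁ D)
    (hψ' : ∀ D, 0 < D → D ≤ K → 1 ≤ ψ₁ D) (r : ℝ) : AdjacentBound K (harmonicStep r V) ψ₁ := by
  intro F u v huv hg hK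
  rcases le_or_gt r u with hru | hur
  · exact hV.step_of_le hψ hψ' huv hg hK hru
  rcases lt_or_ge r v with hrv | hvr
  · exact hV.step_of_between hψ hψ' hg hK hur hrv
  have key : ∀ p ∈ insert (-v) (insert (-u) (F.image (fun w => -w))),
      -p ∈ insert u (insert v F) := by
    intro p hp
    simp only [Finset.mem_insert, Finset.mem_image] at hp ⊢
    rcases hp with rfl | rfl | ⟨z, hz, rfl⟩ <;> simp [*]
  have := hV.neg.step_of_le hψ hψ' (F := F.image (fun w => -w)) (r := -r) (u := -v) (v := -u)
    (by linarith) (by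
      intro w hw
      obtain ⟨z, hz, rfl⟩ := Finset.mem_image.1 hw
      rcases hg z hz with h | h
      · exact Or.inr (by linarith)
      · exact Or.inl (by linarith))
    (fun p hp q hq => by linarith [hK _ (key q hq) _ (key p hp)]) (by linarith)
  rw [← harmonicStep_neg r V (insert u F), ← harmonicStep_neg r V (insert v F),
    Finset.image_insert, Finset.image_insert, abs_sub_comm]
  convert this using 2 <;> ring_nf

/-- The index of `ψ` counts the remaining requests; with none left both costs vanish. -/
lemma adjacentBound_harmonicCost (ψ : ℕ → ℝ → ℝ)
    (hψ : ∀ k D E, 0 < D → D ≤ E → ψ k E + 2 * (E - D) / E ≤ ψ (k + 1) D)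
    (hψ' : ∀ k D, 0 < D → D ≤ K → 1 ≤ ψ k D) (rs : List ℝ) :
    AdjacentBound K (harmonicCost rs) (ψ rs.length) := by
  induction rs with
  | nil =>
    intro F u v huv _ hK
    have h1 := hψ' 0 (v - u) (by linarith) (hK u (by simp) v (by simp))
    simp only [harmonicCost, List.foldr_nil, sub_self, abs_zero, List.length_nil]
    exact mul_nonneg (by linarith) (by linarith)
  | cons r rs ih => exact ih.step (hψ _) (hψ' _) r

/-! ### From adjacent moves to a comparison with an arbitrary matching. -/

/-- The adjacent bound is additive along chains of free points. -/
lemma abs_erase_sub_erase_le {δ α : ℝ} (hV : AdjacentBound K V ψ₀)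
    (hψ : ∀ D, δ ≤ D → D ≤ K → ψ₀ D ≤ α) {F : Finset ℝ}
    (hK : ∀ p ∈ F, ∀ q ∈ F, q - p ≤ K) (hδ : ∀ p ∈ F, ∀ q ∈ F, p < q → δ ≤ q - p) {a b : ℝ}
    (ha : a ∈ F) (hb : b ∈ F) : |V (F.erase a) - V (F.erase b)| ≤ α * |a - b| := by
  have main : ∀ k : ℕ, ∀ a ∈ F, ∀ b ∈ F, a < b → (F.filter (fun w => a < w ∧ w < b)).card ≤ k →
      |V (F.erase a) - V (F.erase b)| ≤ α * (b - a) := by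
    intro k
    induction k using Nat.strong_induction_on with
    | _ k ih =>
    intro a ha b hb hab hk
    -- For consecutive free points, erasing `a` instead of `b` means moving one free point across
    -- that gap. Otherwise split at a free point `c` in between.
    rcases (F.filter (fun w => a < w ∧ w < b)).eq_empty_or_nonempty with he | ⟨c, hc⟩
    · have e1 : F.erase a = insert b ((F.erase a).erase b) := by
        rw [Finset.insert_erase]
        exact Finset.mem_erase.2 ⟨hab.ne', hb⟩
      have e2 : F.erase b = insert a ((F.erase a).erase b) := by
        rw [Finset.erase_right_comm, Finset.insert_erase]
        exact Finset.mem_erase.2 ⟨hab.ne, ha⟩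
      have hsub : ∀ z ∈ insert a (insert b ((F.erase a).erase b)), z ∈ F := by
        intro z hz
        simp only [Finset.mem_insert, Finset.mem_erase] at hz
        rcases hz with rfl | rfl | hz
        exacts [ha, hb, hz.2.2]
      have := hV ((F.erase a).erase b) a b hab (by
          intro w hw
          simp only [Finset.mem_erase] at hw
          by_contra hcon
          push Not at hcon
          have : w ∈ F.filter (fun w => a < w ∧ w < b) :=
            Finset.mem_filter.2 ⟨hw.2.2, lt_of_le_of_ne hcon.1 (Ne.symm hw.2.1),
              lt_of_le_of_ne hcon.2 hw.1⟩
          simp [he] at this)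
        (fun p hp q hq => hK p (hsub p hp) q (hsub q hq))
      rw [e1, e2, abs_sub_comm]
      rw [← e1, ← e2] at this ⊢
      refine this.trans ?_
      rw [mul_comm]
      have : 0 ≤ b - a := by linarith
      gcongr
      exact hψ _ (hδ a ha b hb hab) (hK a ha b hb)
    · rw [Finset.mem_filter] at hc
      obtain ⟨hcF, hac, hcb⟩ := hc
      have c1 : (F.filter (fun w => a < w ∧ w < c)).card <
          (F.filter (fun w => a < w ∧ w < b)).card := by
        apply Finset.card_lt_card
        refine ⟨fun w hw => ?_, fun h => ?_⟩
        · rw [Finset.mem_filter] at hw ⊢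
          exact ⟨hw.1, hw.2.1, hw.2.2.trans hcb⟩
        · have := h (Finset.mem_filter.2 ⟨hcF, hac, hcb⟩)
          simp at this
      have c2 : (F.filter (fun w => c < w ∧ w < b)).card <
          (F.filter (fun w => a < w ∧ w < b)).card := by
        apply Finset.card_lt_card
        refine ⟨fun w hw => ?_, fun h => ?_⟩
        · rw [Finset.mem_filter] at hw ⊢
          exact ⟨hw.1, hac.trans hw.2.1, hw.2.2⟩
        · have := h (Finset.mem_filter.2 ⟨hcF, hac, hcb⟩)
          simp at this
      have i1 := ih _ (c1.trans_le hk) a ha c hcF hac le_rfl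
      have i2 := ih _ (c2.trans_le hk) c hcF b hb hcb le_rfl
      have := abs_sub_le (V (F.erase a)) (V (F.erase c)) (V (F.erase b))
      linarith
  rcases lt_trichotomy a b with h | rfl | h
  · rw [abs_sub_comm a b, abs_of_pos (by linarith : 0 < b - a)]
    exact main _ a ha b hb h le_rfl
  · simp
  · rw [abs_sub_comm, abs_of_pos (by linarith : 0 < a - b)]
    exact main _ b hb a ha h le_rfl

/-- Serving the first request harmonically instead of at `o` costs at most `(2 + 3 * α)` times
the distance to `o`. -/
lemma harmonicStep_le {α : ℝ} (hα : 0 ≤ α) {F : Finset ℝ}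
    (hV : ∀ a ∈ F, ∀ b ∈ F, |V (F.erase a) - V (F.erase b)| ≤ α * |a - b|) (r : ℝ) {o : ℝ}
    (ho : o ∈ F) : harmonicStep r V F ≤ (2 + 3 * α) * |r - o| + V (F.erase o) := by
  have hro := abs_nonneg (r - o)
  have hX : ∀ w ∈ F, |r - w| + V (F.erase w) ≤
      (1 + α) * |r - w| + α * |r - o| + V (F.erase o) := by
    intro w hw
    have h1 := (le_abs_self _).trans (hV w hw o ho)
    have h2 : α * |w - o| ≤ α * (|r - w| + |r - o|) := by
      gcongr
      have := abs_sub_le w r o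
      rwa [abs_sub_comm w r] at this
    linarith
  rcases neighbours_cases ⟨o, ho⟩ r with ⟨L, hL, R, hR, hLR, hLr, hrR, hg⟩ | ⟨L, hL, hLr, hg⟩ |
    ⟨R, hR, hrR, hg⟩
  · have a : 0 ≤ r - L := by linarith
    have b : 0 ≤ R - r := by linarith
    have hpos : 0 < R - L := by linarith
    have xL := hX L hL
    have xR := hX R hR
    rw [harmonicStep, harmonicExp_between _ hL hR hLR hLr hrR hg, div_le_iff₀ hpos]
    have i1 := mul_le_mul_of_nonneg_left xL b
    have i2 := mul_le_mul_of_nonneg_left xR a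
    -- The expected distance is `2 * (r - L) * (R - r) / (R - L)`, at most twice the smaller of `r -
    -- L` and `R - r`; as `o` is free, it is not strictly between `L` and `R`, so `|r - o|` is at
    -- least that smaller distance.
    have hmin : (r - L) * (R - r) ≤ (R - L) * |r - o| := by
      rcases hg o ho with h | h
      · have := le_abs_self (r - o)
        calc _ ≤ |r - o| * (R - L) := by
              apply mul_le_mul _ _ b hro <;> linarith
          _ = _ := mul_comm _ _
      · have := neg_le_abs (r - o)
        apply mul_le_mul _ _ b hpos.le <;> linarith
    have eL : |r - L| = r - L := abs_of_nonneg a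
    have eR : |r - R| = R - r := by rw [abs_sub_comm]; exact abs_of_nonneg b
    rw [eL] at i1 ⊢
    rw [eR] at i2 ⊢
    have hmin' := mul_le_mul_of_nonneg_left hmin (by linarith : 0 ≤ 2 * (1 + α))
    nlinarith
  · rw [harmonicStep, harmonicExp_of_le_right _ hL hLr hg]
    have h1 : |r - L| ≤ |r - o| := by
      rw [abs_of_nonneg (by linarith : 0 ≤ r - L)]
      exact le_trans (by linarith [hg o ho]) (le_abs_self _)
    have := mul_le_mul_of_nonneg_left h1 (by linarith : 0 ≤ 1 + α)
    nlinarith [hX L hL]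
  · rw [harmonicStep, harmonicExp_of_le_left _ hR hrR hg]
    have h1 : |r - R| ≤ |r - o| := by
      rw [abs_sub_comm, abs_of_nonneg (by linarith : 0 ≤ R - r)]
      exact le_trans (by linarith [hg o ho]) (neg_le_abs _)
    have := mul_le_mul_of_nonneg_left h1 (by linarith : 0 ≤ 1 + α)
    nlinarith [hX R hR]

/-- The harmonic algorithm against an arbitrary matching. -/
lemma harmonicCost_le {δ α : ℝ} (hα : 0 ≤ α) (N : ℕ) (ψ : ℕ → ℝ → ℝ)
    (hψ : ∀ k D E, 0 < D → D ≤ E → ψ k E + 2 * (E - D) / E ≤ ψ (k + 1) D)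
    (hψ' : ∀ k D, 0 < D → D ≤ K → 1 ≤ ψ k D)
    (hψα : ∀ k ≤ N, ∀ D, δ ≤ D → D ≤ K → ψ k D ≤ α) (l : List (ℝ × ℝ)) (hN : l.length ≤ N)
    (F : Finset ℝ) (hK : ∀ p ∈ F, ∀ q ∈ F, q - p ≤ K)
    (hδ : ∀ p ∈ F, ∀ q ∈ F, p < q → δ ≤ q - p) (hnd : (l.map Prod.snd).Nodup)
    (hmem : ∀ q ∈ l, q.2 ∈ F) :
    harmonicCost (l.map Prod.fst) F ≤ (2 + 3 * α) * (l.map fun q => |q.1 - q.2|).sum := by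
  induction l generalizing F with
  | nil => simp [harmonicCost]
  | cons q l ih =>
    simp only [List.length_cons] at hN
    simp only [List.map_cons, List.nodup_cons] at hnd
    have hq := hmem q (by simp)
    have h1 := harmonicStep_le (V := harmonicCost (l.map Prod.fst)) hα (F := F)
      (fun a ha b hb => abs_erase_sub_erase_le
        (adjacentBound_harmonicCost ψ hψ hψ' _)
        (hψα _ (by simp; omega)) hK hδ ha hb) q.1 hq
    -- After the first request has been moved to its target `q.2`, the other targets are still free
    -- because all targets are distinct.
    have h2 := ih (by omega) (F.erase q.2)
      (fun a ha b hb => hK a (Finset.mem_of_mem_erase ha) b (Finset.mem_of_mem_erase hb))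
      (fun a ha b hb => hδ a (Finset.mem_of_mem_erase ha) b (Finset.mem_of_mem_erase hb))
      hnd.2 (fun p hp => Finset.mem_erase.2
        ⟨fun h => hnd.1 (h ▸ List.mem_map_of_mem hp), hmem p (by simp [hp])⟩)
    have e : harmonicCost ((q :: l).map Prod.fst) F =
      harmonicStep q.1 (harmonicCost (l.map Prod.fst)) F := rfl
    rw [e, List.map_cons, List.sum_cons]
    linarith

end Discrepancy

/-! ### Embedding the slots in the real line. -/

namespace WeightedLine

variable {m : ℕ} (G : WeightedLine m)

/-- The position of a slot on the real line, the first slot being at `0`. -/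
noncomputable def pos (v : Fin m) : ℝ :=
  ∑ k ∈ Finset.univ.filter (fun k : Fin (m - 1) => k.val < v.val), G.weight k

lemma dist_comm (u v : Fin m) : G.dist u v = G.dist v u := by
  simp only [dist, min_comm u.val, max_comm u.val]

lemma dist_eq_sub {u v : Fin m} (h : u ≤ v) : G.dist u v = G.pos v - G.pos u := by
  have h' : u.val ≤ v.val := h
  have hd : Disjoint (Finset.univ.filter (fun k : Fin (m - 1) =>
      u.val ≤ k.val ∧ k.val < v.val)) (Finset.univ.filter (fun k : Fin (m - 1) =>
      k.val < u.val)) := by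
    rw [Finset.disjoint_filter]
    intro k _ hk
    omega
  rw [eq_sub_iff_add_eq, dist, min_eq_left h', max_eq_right h', pos, pos, ← Finset.sum_union hd]
  congr 1
  ext k
  simp only [Finset.mem_union, Finset.mem_filter, Finset.mem_univ, true_and]
  omega

lemma pos_strictMono : StrictMono G.pos := by
  intro u v huv
  have h' : u.val < v.val := huv
  rw [← sub_pos, ← G.dist_eq_sub huv.le, dist, min_eq_left h'.le, max_eq_right h'.le]
  refine Finset.sum_pos (fun k _ => G.weight_pos k) ⟨⟨u.val, by omega⟩, ?_⟩
  simpa using h'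

lemma dist_eq_abs (u v : Fin m) : G.dist u v = |G.pos u - G.pos v| := by
  rcases le_total u v with h | h
  · rw [G.dist_eq_sub h, abs_sub_comm, abs_of_nonneg]
    exact sub_nonneg.2 (G.pos_strictMono.monotone h)
  · rw [G.dist_comm, G.dist_eq_sub h, abs_of_nonneg]
    exact sub_nonneg.2 (G.pos_strictMono.monotone h)

lemma dist_nonneg (u v : Fin m) : 0 ≤ G.dist u v := by
  rw [dist_eq_abs]; exact abs_nonneg _

lemma dist_pos {u v : Fin m} (h : u ≠ v) : 0 < G.dist u v := by
  rw [dist_eq_abs]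
  exact abs_pos.2 (sub_ne_zero.2 (G.pos_strictMono.injective.ne h))

lemma dist_le_dMax (u v : Fin m) : G.dist u v ≤ G.dMax :=
  le_ciSup (f := fun q : Fin m × Fin m => G.dist q.1 q.2) (Set.finite_range _).bddAbove (u, v)

lemma dMin_le_dist {u v : Fin m} (h : u ≠ v) : G.dMin ≤ G.dist u v :=
  ciInf_le (f := fun q : {q : Fin m × Fin m // q.1 ≠ q.2} => G.dist q.1.1 q.1.2)
    (Set.finite_range _).bddBelow ⟨(u, v), h⟩

lemma dMin_pos (hm : 2 ≤ m) : 0 < G.dMin := by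
  have : Nonempty {q : Fin m × Fin m // q.1 ≠ q.2} :=
    ⟨⟨(⟨0, by omega⟩, ⟨1, by omega⟩), by simp⟩⟩
  obtain ⟨q, hq⟩ := exists_eq_ciInf_of_finite
    (f := fun q : {q : Fin m × Fin m // q.1 ≠ q.2} => G.dist q.1.1 q.1.2)
  rw [dMin, ← hq]
  exact G.dist_pos q.2

/-- This keeps `log (dMax / dMin)` at least `log 2`, so that it can absorb additive constants; with
two slots it would be zero. -/
lemma two_mul_dMin_le_dMax (hm : 3 ≤ m) : 2 * G.dMin ≤ G.dMax := by
  have h01 := G.dMin_le_dist (u := ⟨0, by omega⟩) (v := ⟨1, by omega⟩) (by simp)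
  have h12 := G.dMin_le_dist (u := ⟨1, by omega⟩) (v := ⟨2, by omega⟩) (by simp)
  have h02 := G.dist_le_dMax ⟨0, by omega⟩ ⟨2, by omega⟩
  rw [G.dist_eq_sub (by simp)] at h01 h12 h02
  linarith

end WeightedLine

/-! ### Equilibrium under harmonic prices is the harmonic choice. -/

section Prices

variable {m : ℕ} (G : WeightedLine m)

/-- Fee differences smaller than the distance for consecutive vacant slots are so for all vacant
slots. -/
lemma fee_sub_lt_of_consecutive {occ : Set (Fin m)} {p : Fin m → ℝ}
    (h : ∀ u v, ConsecutiveVacant occ u v → -G.dist u v < p u - p v ∧ p u - p v < G.dist u v)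
    (u v : Fin m) (hu : u ∉ occ) (hv : v ∉ occ) (huv : u < v) :
    -(G.pos v - G.pos u) < p u - p v ∧ p u - p v < G.pos v - G.pos u := by
  obtain ⟨k, hk⟩ : ∃ k, v.val - u.val = k := ⟨_, rfl⟩
  induction k using Nat.strong_induction_on generalizing u v with
  | _ k ih =>
  by_cases hc : ∃ w, u < w ∧ w < v ∧ w ∉ occ
  · obtain ⟨w, huw, hwv, hw⟩ := hc
    have h1 : u.val < w.val := huw
    have h2 : w.val < v.val := hwv
    have i1 := ih (w.val - u.val) (by omega) u w hu hw huw rfl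
    have i2 := ih (v.val - w.val) (by omega) w v hw hv hwv rfl
    constructor <;> linarith [i1.1, i1.2, i2.1, i2.2]
  · push Not at hc
    rw [← G.dist_eq_sub huv.le]
    exact h u v ⟨hu, hv, huv, hc⟩

/-- A vacant slot `l` on the way from the goal to a vacant slot `v` is strictly better than `v`. -/
lemma dist_add_fee_lt {occ : Set (Fin m)} {p : Fin m → ℝ}
    (h : ∀ u v, ConsecutiveVacant occ u v → -G.dist u v < p u - p v ∧ p u - p v < G.dist u v)
    {g l v : Fin m} (hl : l ∉ occ) (hv : v ∉ occ) (hlv : v < l ∧ l ≤ g ∨ g ≤ l ∧ l < v) :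
    G.dist g l + p l < G.dist g v + p v := by
  rcases hlv with ⟨h1, h2⟩ | ⟨h1, h2⟩
  · have := fee_sub_lt_of_consecutive G h v l hv hl h1
    rw [G.dist_comm g l, G.dist_comm g v, G.dist_eq_sub h2, G.dist_eq_sub (h1.le.trans h2)]
    linarith [this.1]
  · have := fee_sub_lt_of_consecutive G h l v hl hv h2
    rw [G.dist_eq_sub h1, G.dist_eq_sub (h1.trans h2.le)]
    linarith [this.2]

variable {Ω : Type*} [MeasurableSpace Ω]

/-- The probability that a uniform variable on `[-(a + b), a + b]` is at most `b - a`. -/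
lemma measureReal_uniform_le {ν : Measure Ω} {Y : Ω → ℝ} {a b : ℝ} (ha : 0 < a) (hb : 0 < b)
    (hY : pdf.IsUniform Y (Set.Icc (-(a + b)) (a + b)) ν volume) :
    ν.real {ω | Y ω ≤ b - a} = b / (a + b) ∧ ν {ω | Y ω = b - a} = 0 := by
  have hvol : (volume : Measure ℝ) (Set.Icc (-(a + b)) (a + b)) = ENNReal.ofReal (2 * (a + b)) := by
    rw [Real.volume_Icc]
    congr 1
    ring
  have h0 : (volume : Measure ℝ) (Set.Icc (-(a + b)) (a + b)) ≠ 0 := by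
    rw [hvol, Ne, ENNReal.ofReal_eq_zero]
    linarith
  have ht : (volume : Measure ℝ) (Set.Icc (-(a + b)) (a + b)) ≠ ∞ := by
    rw [hvol]
    exact ENNReal.ofReal_ne_top
  constructor
  · have h1 : ν {ω | Y ω ≤ b - a} = _ := hY.measure_preimage h0 ht (measurableSet_Iic (a := b - a))
    have h2 : Set.Icc (-(a + b)) (a + b) ∩ Set.Iic (b - a) = Set.Icc (-(a + b)) (b - a) := by
      ext z
      simp only [Set.mem_inter_iff, Set.mem_Icc, Set.mem_Iic]
      constructor
      · rintro ⟨⟨h1, _⟩, h3⟩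
        exact ⟨h1, h3⟩
      · rintro ⟨h1, h3⟩
        exact ⟨⟨h1, by linarith⟩, h3⟩
    rw [Measure.real, h1, h2, hvol, Real.volume_Icc, ENNReal.toReal_div,
      ENNReal.toReal_ofReal (by linarith), ENNReal.toReal_ofReal (by linarith)]
    field_simp
    ring
  · have h1 : ν {ω | Y ω = b - a} = _ :=
      hY.measure_preimage h0 ht (measurableSet_singleton (b - a))
    rw [h1, measure_mono_null Set.inter_subset_right (by simp), ENNReal.zero_div]

/-- Under the Harmonic Payment Conditions a car parks at the harmonic random choice of a vacant
slot next to its goal. -/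
lemma integral_eq_harmonicExp {ν : Measure Ω} [IsProbabilityMeasure ν] {S : Finset (Fin m)}
    {p : Fin m → Ω → ℝ} {g : Fin m} {X : Ω → Fin m} (hX : Measurable X) {occ : Set (Fin m)}
    (hS : ∀ v, v ∈ S ↔ v ∉ occ) (hP : HarmonicPrices ν G occ p)
    (hE : ∀ᵐ ω ∂ν, X ω ∉ occ ∧ ∀ v, v ∉ occ →
      G.dist g (X ω) + p (X ω) ω ≤ G.dist g v + p v ω) (φ : ℝ → ℝ) :
    ∫ ω, φ (G.pos (X ω)) ∂ν = harmonicExp (S.image G.pos) (G.pos g) φ := by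
  have hmono := G.pos_strictMono
  have hbest : ∀ᵐ ω ∂ν, X ω ∈ S ∧ ∀ l ∈ S, ¬ (X ω < l ∧ l ≤ g ∨ g ≤ l ∧ l < X ω) := by
    filter_upwards [hE, hP.2] with ω h1 h2
    refine ⟨(hS _).2 h1.1, fun l hl hc => ?_⟩
    have := dist_add_fee_lt G (p := fun v => p v ω) h2 ((hS _).1 hl) h1.1 hc
    exact absurd (h1.2 l ((hS _).1 hl)) (not_le.2 this)
  have hne : S.Nonempty := by
    obtain ⟨ω, hω⟩ := hbest.exists
    exact ⟨_, hω.1⟩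
  have const : ∀ l, (∀ᵐ ω ∂ν, X ω = l) → ∫ ω, φ (G.pos (X ω)) ∂ν = φ (G.pos l) := by
    intro l hl
    rw [integral_congr_ae (g := fun _ => φ (G.pos l))]
    · simp
    · filter_upwards [hl] with ω hω
      rw [hω]
  have himg : ∀ {q : ℝ → Prop}, (∀ w ∈ S.image G.pos, q w) ↔ ∀ v ∈ S, q (G.pos v) := by
    intro q
    simp
  rcases neighbours_cases (hne.image G.pos) (G.pos g) with
    ⟨L, hL, R, hR, hLR, hLr, hrR, hg⟩ | ⟨L, hL, hLr, hg⟩ | ⟨R, hR, hrR, hg⟩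
  · rw [harmonicExp_between _ hL hR hLR hLr hrR hg]
    obtain ⟨l, hl, rfl⟩ := Finset.mem_image.1 hL
    obtain ⟨r, hr, rfl⟩ := Finset.mem_image.1 hR
    have hpos : G.pos r - G.pos l ≠ 0 := by linarith
    rw [himg] at hg
    have hg' : ∀ v ∈ S, v ≤ l ∨ r ≤ v := fun v hv =>
      (hg v hv).imp hmono.le_iff_le.1 hmono.le_iff_le.1
    have hlr : l < r := hmono.lt_iff_lt.1 hLR
    have hlg : l ≤ g := hmono.le_iff_le.1 hLr
    have hgr : g ≤ r := hmono.le_iff_le.1 hrR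
    rcases eq_or_lt_of_le hlg with rfl | hlg'
    · rw [const l]
      · rw [sub_self, zero_mul, add_zero, mul_div_cancel_left₀ _ hpos]
      · filter_upwards [hbest] with ω hω
        by_contra hne
        rcases lt_or_gt_of_ne hne with h | h
        · exact hω.2 l hl (Or.inl ⟨h, le_rfl⟩)
        · exact hω.2 l hl (Or.inr ⟨le_rfl, h⟩)
    rcases eq_or_lt_of_le hgr with rfl | hgr'
    · rw [const g]
      · rw [sub_self, zero_mul, zero_add, mul_div_cancel_left₀ _ hpos]
      · filter_upwards [hbest] with ω hω
        by_contra hne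
        rcases lt_or_gt_of_ne hne with h | h
        · exact hω.2 g hr (Or.inl ⟨h, le_rfl⟩)
        · exact hω.2 g hr (Or.inr ⟨le_rfl, h⟩)
    -- The goal lies strictly between consecutive vacant slots, hence in a block, and the uniform
    -- law is available.
    have hflank : FlanksBlock occ l r := by
      refine ⟨⟨(hS _).1 hl, (hS _).1 hr, hlr, fun w h1 h2 => ?_⟩, g, hlg', hgr'⟩
      by_contra hw
      rcases hg' w ((hS _).2 hw) with h | h
      · exact absurd h1 (not_lt.2 h)
      · exact absurd h2 (not_lt.2 h)
    have ha : 0 < G.dist g l := G.dist_pos hlg'.ne'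
    have hb : 0 < G.dist g r := G.dist_pos hgr'.ne
    have ea : G.dist g l = G.pos g - G.pos l := by rw [G.dist_comm, G.dist_eq_sub hlg]
    have eb : G.dist g r = G.pos r - G.pos g := G.dist_eq_sub hgr
    have hU := hP.1 l r hflank
    rw [show G.dist l r = G.dist g l + G.dist g r by
      rw [ea, eb, G.dist_eq_sub hlr.le]; ring] at hU
    obtain ⟨hprob, hnull⟩ := measureReal_uniform_le ha hb hU
    have hXlr : ∀ᵐ ω ∂ν, X ω = l ∨ X ω = r := by
      filter_upwards [hbest] with ω hω
      rcases hg' _ hω.1 with h | h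
      · left
        by_contra hne
        exact hω.2 l hl (Or.inl ⟨lt_of_le_of_ne h hne, hlg⟩)
      · right
        by_contra hne
        exact hω.2 r hr (Or.inr ⟨hgr, lt_of_le_of_ne h (Ne.symm hne)⟩)
    -- Equality of the two total prices is a null event, so the tie-breaking rule is irrelevant.
    have hset : {ω | X ω = l} =ᵐ[ν] {ω | p l ω - p r ω ≤ G.dist g r - G.dist g l} := by
      have hnull' : ∀ᵐ ω ∂ν, ¬ (p l ω - p r ω = G.dist g r - G.dist g l) := by
        rw [ae_iff]
        simpa using hnull
      filter_upwards [hXlr, hE, hnull'] with ω h1 h2 h3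
      apply propext
      change X ω = l ↔ p l ω - p r ω ≤ G.dist g r - G.dist g l
      constructor
      · intro h
        have := h2.2 r ((hS _).1 hr)
        rw [h] at this
        linarith
      · intro h
        refine h1.resolve_right fun h4 => h3 ?_
        have := h2.2 l ((hS _).1 hl)
        rw [h4] at this
        linarith
    have hmeas : MeasurableSet {ω | X ω = l} := hX (measurableSet_singleton l)
    have hint : ∫ ω, φ (G.pos (X ω)) ∂ν = ∫ ω, (φ (G.pos r) +
        {ω | X ω = l}.indicator (fun _ => φ (G.pos l) - φ (G.pos r)) ω) ∂ν := by
      apply integral_congr_ae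
      filter_upwards [hXlr] with ω hω
      by_cases h : X ω = l
      · rw [Set.indicator_of_mem (by exact h), h]
        ring
      · rw [Set.indicator_of_notMem (by exact h), hω.resolve_left h, add_zero]
    rw [hint, integral_add (integrable_const _) ((integrable_const _).indicator hmeas),
      integral_indicator_const _ hmeas, measureReal_congr hset, hprob, ea, eb]
    simp only [integral_const, probReal_univ, smul_eq_mul, one_mul]
    have : G.pos g - G.pos l + (G.pos r - G.pos g) ≠ 0 := by
      intro h
      apply hpos
      linarith
    field_simp
    ring
  · rw [harmonicExp_of_le_right _ hL hLr hg]
    obtain ⟨l, hl, rfl⟩ := Finset.mem_image.1 hL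
    rw [himg] at hg
    refine const l ?_
    filter_upwards [hbest] with ω hω
    by_contra hne
    exact hω.2 l hl (Or.inl ⟨lt_of_le_of_ne (hmono.le_iff_le.1 (hg _ hω.1)) hne,
      hmono.le_iff_le.1 hLr⟩)
  · rw [harmonicExp_of_le_left _ hR hrR hg]
    obtain ⟨r, hr, rfl⟩ := Finset.mem_image.1 hR
    rw [himg] at hg
    refine const r ?_
    filter_upwards [hbest] with ω hω
    by_contra hne
    exact hω.2 r hr (Or.inr ⟨hmono.le_iff_le.1 hrR,
      lt_of_le_of_ne (hmono.le_iff_le.1 (hg _ hω.1)) (Ne.symm hne)⟩)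

end Prices

/-! ### The expected social cost as `harmonicCost`. -/

section Assignment

variable {m n : ℕ} {Ω : Type*}

/-- The slots that are vacant after the first `k` cars have parked according to `y`. -/
def vacantAfter (y : Fin n → Fin m) (k : ℕ) : Finset (Fin m) :=
  Finset.univ.filter fun v => ∀ i : Fin n, i.val < k → y i ≠ v

lemma vacantAfter_zero (y : Fin n → Fin m) : vacantAfter y 0 = Finset.univ := by
  simp [vacantAfter]

lemma vacantAfter_succ (y : Fin n → Fin m) (i : Fin n) :
    vacantAfter y (i + 1) = (vacantAfter y i).erase (y i) := by
  ext v
  simp only [vacantAfter, Finset.mem_filter, Finset.mem_univ, true_and, Finset.mem_erase]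
  constructor
  · exact fun h => ⟨(h i (Nat.lt_succ_self _)).symm, fun j hj => h j (Nat.lt_succ_of_lt hj)⟩
  · rintro ⟨h1, h2⟩ j hj
    rcases Nat.lt_succ_iff_lt_or_eq.1 hj with h | h
    · exact h2 j h
    · rw [Fin.ext h]
      exact h1.symm

lemma mem_vacantAfter_iff (x : Fin n → Ω → Fin m) (i : Fin n) (ω : Ω) (v : Fin m) :
    v ∈ vacantAfter (fun j => x j ω) i ↔ v ∉ Set.range (parkedBefore x i ω) := by
  simp only [vacantAfter, Finset.mem_filter, Finset.mem_univ, true_and, Set.mem_range,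
    parkedBefore, not_exists]
  constructor
  · intro h j
    exact h (Fin.castLE i.isLt.le j) j.isLt
  · intro h j hj
    exact h ⟨j, hj⟩

variable [MeasurableSpace Ω] {μ : Measure Ω}

/-- Two integrals agree if they agree conditionally on every value of a finite random variable. -/
lemma integral_eq_of_cond_eq [IsProbabilityMeasure μ] {β : Type*} [Fintype β] [MeasurableSpace β]
    [MeasurableSingletonClass β] {Y : Ω → β} (hY : Measurable Y) {f₁ f₂ : Ω → ℝ}
    (h₁ : Integrable f₁ μ) (h₂ : Integrable f₂ μ)
    (h : ∀ b, μ {ω | Y ω = b} ≠ 0 → ∫ ω, f₁ ω ∂μ[|{ω | Y ω = b}] = ∫ ω, f₂ ω ∂μ[|{ω | Y ω = b}]) :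
    ∫ ω, f₁ ω ∂μ = ∫ ω, f₂ ω ∂μ := by
  have hm : ∀ b, MeasurableSet {ω | Y ω = b} := fun b => hY (measurableSet_singleton b)
  have hdis : Pairwise (Function.onFun Disjoint fun b => {ω | Y ω = b}) := by
    intro b c hbc
    refine Set.disjoint_left.2 fun ω h1 h2 => hbc ?_
    exact (show Y ω = b from h1).symm.trans h2
  have huniv : (⋃ b, {ω | Y ω = b}) = Set.univ := by
    ext ω
    simp
  have key : ∀ f : Ω → ℝ, Integrable f μ → ∫ ω, f ω ∂μ = ∑ b, ∫ ω in {ω | Y ω = b}, f ω ∂μ := by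
    intro f hf
    rw [← integral_iUnion_fintype hm hdis fun b => hf.integrableOn, huniv, setIntegral_univ]
  rw [key f₁ h₁, key f₂ h₂]
  refine Finset.sum_congr rfl fun b _ => ?_
  by_cases h0 : μ {ω | Y ω = b} = 0
  · rw [Measure.restrict_eq_zero.2 h0]
    simp
  · have := h b h0
    rw [ProbabilityTheory.cond, integral_smul_measure, integral_smul_measure, smul_eq_mul,
      smul_eq_mul] at this
    refine mul_left_cancel₀ ?_ this
    rw [ENNReal.toReal_inv]
    exact inv_ne_zero (ENNReal.toReal_ne_zero.2 ⟨h0, measure_ne_top _ _⟩)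

lemma measurable_parkedBefore {x : Fin n → Ω → Fin m} (hx : ∀ i, Measurable (x i)) (i : Fin n) :
    Measurable (parkedBefore x i) :=
  measurable_pi_lambda _ fun _ => hx _

lemma integrable_comp_assignment [IsFiniteMeasure μ] {x : Fin n → Ω → Fin m}
    (hx : ∀ i, Measurable (x i)) (f : (Fin n → Fin m) → ℝ) :
    Integrable (fun ω => f (fun i => x i ω)) μ := by
  have hX : Measurable fun ω i => x i ω := measurable_pi_lambda _ hx
  have : Integrable f (μ.map fun ω i => x i ω) := Integrable.of_finite
  exact this.comp_measurable hX

/-- The expected cost of the harmonic algorithm for the cars from `k` on, when the cars before `k`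
are parked according to `y`. -/
noncomputable def harmonicCostAfter (G : WeightedLine m) (g y : Fin n → Fin m) (k : ℕ) : ℝ :=
  harmonicCost ((List.ofFn fun i => G.pos (g i)).drop k) ((vacantAfter y k).image G.pos)

/-- Given the history, the vacant set is fixed and car `i` makes one harmonic step. No independence
between rounds is needed: the remaining cost is a function of the vacant set alone. -/
lemma integral_harmonicCostAfter [IsProbabilityMeasure μ] (G : WeightedLine m)
    {P : PricingScheme m n Ω} {g : Fin n → Fin m} {x : Fin n → Ω → Fin m}
    (hx : ∀ i, Measurable (x i)) (hE : IsEquilibrium μ G P g x)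
    (hP : HarmonicPaymentConditions μ G P x) (i : Fin n) :
    ∫ ω, harmonicCostAfter G g (fun j => x j ω) i ∂μ =
      ∫ ω, G.dist (g i) (x i ω) ∂μ +
        ∫ ω, harmonicCostAfter G g (fun j => x j ω) (i + 1) ∂μ := by
  have hint1 := integrable_comp_assignment (μ := μ) hx fun y => harmonicCostAfter G g y i
  have hint2 := integrable_comp_assignment (μ := μ) hx fun y => harmonicCostAfter G g y (i + 1)
  have hint3 := integrable_comp_assignment (μ := μ) hx fun y => G.dist (g i) (y i)
  rw [← integral_add hint3 hint2]
  refine integral_eq_of_cond_eq (measurable_parkedBefore hx i) hint1 (hint3.add hint2) ?_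
  intro h h0
  have hA : MeasurableSet {ω | parkedBefore x i ω = h} :=
    measurable_parkedBefore hx i (measurableSet_singleton h)
  have : IsProbabilityMeasure μ[|{ω | parkedBefore x i ω = h}] := cond_isProbabilityMeasure h0
  have hmem : ∀ᵐ ω ∂μ[|{ω | parkedBefore x i ω = h}], parkedBefore x i ω = h :=
    ae_cond_mem hA
  have hE' : ∀ᵐ ω ∂μ[|{ω | parkedBefore x i ω = h}], x i ω ∉ Set.range h ∧
      ∀ v, v ∉ Set.range h →
        G.dist (g i) (x i ω) + P i h (x i ω) ω ≤ G.dist (g i) v + P i h v ω := by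
    filter_upwards [hmem, cond_absolutelyContinuous.ae_le hE] with ω h1 h2
    have := h2 i
    rwa [h1] at this
  classical
  obtain ⟨S, hS⟩ : ∃ S : Finset (Fin m), ∀ v, v ∈ S ↔ v ∉ Set.range h :=
    ⟨Finset.univ.filter fun v => v ∉ Set.range h, by simp⟩
  have hvac : ∀ ω, parkedBefore x i ω = h → vacantAfter (fun j => x j ω) i = S := by
    intro ω hω
    ext v
    rw [mem_vacantAfter_iff, hω, hS]
  have hdrop : (List.ofFn fun i => G.pos (g i)).drop i =
      G.pos (g i) :: (List.ofFn fun i => G.pos (g i)).drop (i + 1) := by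
    rw [List.drop_eq_getElem_cons (by simp)]
    simp
  have main := integral_eq_harmonicExp G (hx i) hS (hP i h h0) hE' fun w =>
    |G.pos (g i) - w| +
      harmonicCost ((List.ofFn fun i => G.pos (g i)).drop (i + 1)) ((S.image G.pos).erase w)
  have e1 : ∫ ω, harmonicCostAfter G g (fun j => x j ω) i ∂μ[|{ω | parkedBefore x i ω = h}] =
      ∫ _, harmonicCost ((List.ofFn fun i => G.pos (g i)).drop i) (S.image G.pos)
        ∂μ[|{ω | parkedBefore x i ω = h}] := by
    apply integral_congr_ae
    filter_upwards [hmem] with ω hω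
    rw [harmonicCostAfter, hvac ω hω]
  rw [e1, integral_const, probReal_univ, one_smul, hdrop]
  refine Eq.trans ?_ (main.symm.trans ?_)
  · rfl
  · apply integral_congr_ae
    filter_upwards [hmem] with ω hω
    rw [harmonicCostAfter, vacantAfter_succ, hvac ω hω, G.dist_eq_abs,
      Finset.image_erase G.pos_strictMono.injective]

/-- The one-car identities telescope, and no cost remains after the last car. -/
lemma integral_socialCost [IsProbabilityMeasure μ] (G : WeightedLine m)
    {P : PricingScheme m n Ω} {g : Fin n → Fin m} {x : Fin n → Ω → Fin m}
    (hx : ∀ i, Measurable (x i)) (hE : IsEquilibrium μ G P g x)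
    (hP : HarmonicPaymentConditions μ G P x) :
    ∫ ω, G.socialCost g (fun i => x i ω) ∂μ =
      harmonicCost (List.ofFn fun i => G.pos (g i)) (Finset.univ.image G.pos) := by
  have h1 : ∫ ω, G.socialCost g (fun i => x i ω) ∂μ = ∑ i, ∫ ω, G.dist (g i) (x i ω) ∂μ :=
    integral_finsetSum _ fun i _ =>
      integrable_comp_assignment (μ := μ) hx fun y => G.dist (g i) (y i)
  have h2 : ∀ i : Fin n, ∫ ω, G.dist (g i) (x i ω) ∂μ =
      ∫ ω, harmonicCostAfter G g (fun j => x j ω) i ∂μ -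
        ∫ ω, harmonicCostAfter G g (fun j => x j ω) (i + 1) ∂μ := fun i => by
    rw [integral_harmonicCostAfter G hx hE hP i, add_sub_cancel_right]
  rw [h1, Finset.sum_congr rfl fun i _ => h2 i,
    Fin.sum_univ_eq_sum_range (fun k => ∫ ω, harmonicCostAfter G g (fun j => x j ω) k ∂μ -
        ∫ ω, harmonicCostAfter G g (fun j => x j ω) (k + 1) ∂μ), Finset.sum_range_sub']
  have hn : (List.ofFn fun i => G.pos (g i)).drop n = [] := by
    rw [List.drop_eq_nil_iff]
    simp
  simp only [harmonicCostAfter, hn, vacantAfter_zero, List.drop_zero, harmonicCost, List.foldr_nil,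
    integral_const, probReal_univ, one_smul, smul_zero, sub_zero]

/-! ### The two choices of `ψ` and the conclusion. -/

/-- The harmonic algorithm against an assignment `y`, for a function `ψ` as in
`adjacentBound_harmonicCost`. -/
lemma harmonicCost_le_socialCost (G : WeightedLine m) (g : Fin n → Fin m) (y : Fin n ↪ Fin m)
    {α : ℝ} (hα : 0 ≤ α) (ψ : ℕ → ℝ → ℝ)
    (hψ : ∀ k D E, 0 < D → D ≤ E → ψ k E + 2 * (E - D) / E ≤ ψ (k + 1) D)
    (hψ' : ∀ k D, 0 < D → D ≤ G.dMax → 1 ≤ ψ k D)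
    (hψα : ∀ k ≤ n, ∀ D, G.dMin ≤ D → D ≤ G.dMax → ψ k D ≤ α) :
    harmonicCost (List.ofFn fun i => G.pos (g i)) (Finset.univ.image G.pos) ≤
      (2 + 3 * α) * G.socialCost g y := by
  have h := harmonicCost_le hα n ψ hψ hψ' hψα
    (List.ofFn fun i => (G.pos (g i), G.pos (y i))) (by simp) (Finset.univ.image G.pos)
    (by
      intro p hp q hq
      obtain ⟨u, -, rfl⟩ := Finset.mem_image.1 hp
      obtain ⟨v, -, rfl⟩ := Finset.mem_image.1 hq
      have := G.dist_le_dMax v u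
      rw [G.dist_eq_abs] at this
      exact (le_abs_self _).trans this)
    (by
      intro p hp q hq hpq
      obtain ⟨u, -, rfl⟩ := Finset.mem_image.1 hp
      obtain ⟨v, -, rfl⟩ := Finset.mem_image.1 hq
      have huv := G.pos_strictMono.lt_iff_lt.1 hpq
      rw [← G.dist_eq_sub huv.le]
      exact G.dMin_le_dist huv.ne)
    (by
      rw [List.map_ofFn, List.nodup_ofFn]
      exact G.pos_strictMono.injective.comp y.injective)
    (by
      intro q hq
      rw [List.mem_ofFn] at hq
      obtain ⟨i, rfl⟩ := hq
      exact Finset.mem_image_of_mem _ (Finset.mem_univ _))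
  rw [List.map_ofFn, List.map_ofFn, List.sum_ofFn] at h
  simp only [WeightedLine.socialCost, G.dist_eq_abs]
  exact h

lemma socialCost_nonneg (G : WeightedLine m) (g y : Fin n → Fin m) : 0 ≤ G.socialCost g y :=
  Finset.sum_nonneg fun _ _ => G.dist_nonneg _ _

/-- The logarithmic bound for the harmonic algorithm. -/
lemma harmonicCost_le_log (hm : 3 ≤ m) (G : WeightedLine m) (g : Fin n → Fin m)
    (y : Fin n ↪ Fin m) :
    harmonicCost (List.ofFn fun i => G.pos (g i)) (Finset.univ.image G.pos) ≤
      (5 + 6 * Real.log (G.dMax / G.dMin)) * G.socialCost g y := by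
  have hmin := G.dMin_pos (by omega)
  have hmax : 0 < G.dMax := by linarith [G.two_mul_dMin_le_dMax hm]
  have hlog : 0 ≤ Real.log (G.dMax / G.dMin) := by
    apply Real.log_nonneg
    rw [le_div_iff₀ hmin]
    linarith [G.two_mul_dMin_le_dMax hm]
  have := harmonicCost_le_socialCost G g y (α := 1 + 2 * Real.log (G.dMax / G.dMin))
    (by linarith) (fun _ D => 1 + 2 * Real.log (G.dMax / D)) ?_ ?_ ?_
  · convert this using 2
    ring
  · intro _ D E hD hDE
    have hE : 0 < E := by linarith
    -- The inequality `1 - D / E ≤ log (E / D)` makes one function `ψ` serve for all numbers of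
    -- remaining requests.
    have h1 := Real.log_le_sub_one_of_pos (div_pos hD hE)
    rw [Real.log_div hD.ne' hE.ne'] at h1
    rw [Real.log_div hmax.ne' hE.ne', Real.log_div hmax.ne' hD.ne',
      show 2 * (E - D) / E = 2 * (1 - D / E) by field_simp]
    linarith
  · intro _ D hD hDK
    have : 0 ≤ Real.log (G.dMax / D) := by
      apply Real.log_nonneg
      rwa [le_div_iff₀ hD, one_mul]
    linarith
  · intro _ _ D hD _
    have : Real.log (G.dMax / D) ≤ Real.log (G.dMax / G.dMin) := by
      apply Real.log_le_log (div_pos hmax (by linarith))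
      gcongr
    linarith

/-- The bound for the harmonic algorithm in terms of the number of cars. -/
lemma harmonicCost_le_card (G : WeightedLine m) (g : Fin n → Fin m) (y : Fin n ↪ Fin m) :
    harmonicCost (List.ofFn fun i => G.pos (g i)) (Finset.univ.image G.pos) ≤
      (5 + 6 * n) * G.socialCost g y := by
  have := harmonicCost_le_socialCost G g y (α := 1 + 2 * n)
    (by positivity) (fun k _ => 1 + 2 * k) ?_ ?_ ?_
  · convert this using 2
    ring
  · intro k D E hD hDE
    have hE : 0 < E := by linarith
    have h1 : 2 * (E - D) / E ≤ 2 := by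
      rw [div_le_iff₀ hE]
      linarith
    push_cast
    linarith
  · intro k _ _ _
    have : (0 : ℝ) ≤ k := k.cast_nonneg
    linarith
  · intro k hk _ _ _
    have : (k : ℝ) ≤ n := by exact_mod_cast hk
    linarith

end Assignment

theorem mainTheorem3 :
    ∃ C : ℝ, 0 < C ∧
      ∀ (m n : ℕ) (_ : 3 ≤ m) (_ : n ≤ m) (G : WeightedLine m)
        (Ω : Type*) [MeasurableSpace Ω] (μ : Measure Ω) [IsProbabilityMeasure μ]
        (P : PricingScheme m n Ω) (g : Fin n → Fin m) (x : Fin n → Ω → Fin m),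
        (∀ i, Measurable (x i)) →
        IsEquilibrium μ G P g x →
        HarmonicPaymentConditions μ G P x →
        ∫ ω, G.socialCost g (fun i => x i ω) ∂μ ≤
          C * min (Real.log (G.dMax / G.dMin)) ((n : ℝ) ^ 2) * G.optCost g := by
  -- Both `5 + 6 * log ≤ 16 * log`, as the logarithm is at least `log 2 > 1 / 2`, and `5 + 6 * n ≤
  -- 16 * n ^ 2` for `n ≥ 1`.
  refine ⟨16, by norm_num, ?_⟩
  intro m n hm hn G Ω _ μ _ P g x hx hE hP
  have : Nonempty (Fin n ↪ Fin m) := ⟨Fin.castLEEmb hn⟩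
  obtain ⟨y, hy⟩ := exists_eq_ciInf_of_finite (f := fun y : Fin n ↪ Fin m => G.socialCost g y)
  rw [integral_socialCost G hx hE hP, WeightedLine.optCost, ← hy]
  have h0 := socialCost_nonneg G g y
  rcases min_choice (Real.log (G.dMax / G.dMin)) ((n : ℝ) ^ 2) with h | h <;> rw [h]
  · refine (harmonicCost_le_log hm G g y).trans (mul_le_mul_of_nonneg_right ?_ h0)
    have hmin := G.dMin_pos (by omega)
    have h2 : Real.log 2 ≤ Real.log (G.dMax / G.dMin) := by
      apply Real.log_le_log two_pos
      rw [le_div_iff₀ hmin]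
      exact G.two_mul_dMin_le_dMax hm
    linarith [Real.log_two_gt_d9]
  · refine (harmonicCost_le_card G g y).trans ?_
    -- For `n = 0` the factor on the right is zero, but so is the cost of `y`.
    rcases Nat.eq_zero_or_pos n with rfl | hpos
    · simp [WeightedLine.socialCost]
    · refine mul_le_mul_of_nonneg_right ?_ h0
      have : (1 : ℝ) ≤ n := by exact_mod_cast hpos
      nlinarith
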